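/- For $\beta>0$ and $L>0$ let $m=\sup\{\ell\in\mathbb{N}:\ell<\beta\}$ and let $\Sigma(\beta,L)$ be the set of all probability densities $f$ on $[0,1]$ that are $m$ times differentiable on $[0,1]$ with $|f^{(m)}(x)-f^{(m)}(y)|\le L|x-y|^{\beta-m}$ for all $x,y\in[0,1]$. For an estimator $\tilde f_n$ based on $n$ i.i.d. observations $X_1,\dots,X_n$ with density $f$, and for $p\ge 1$, put $$R_n(\tilde f_n,f)=\bigl(E_f^n\|\tilde f_n-f\|_{L^p([0,1])}^p\bigr)^{1/p},\qquad R_n(\tilde f_n,\beta,L)=\sup_{f\in\Sigma(\beta,L)}R_n(\tilde f_n,f),\qquad r_n(\beta,L)=\inf_{\tilde f_n}R_n(\tilde f_n,\beta,L),$$ where $E_f^n$ is the expectation with respect to the law of $(X_1,\dots,X_n)$ and the infimum is over all estimators. For $b\in(0,1)$ the beta kernel estimator is $$\hat f_b(t)=\frac1n\sum_{k=1}^nK_{t,b}(X_k),\quad t\in[0,1],\qquad K_{t,b}(x)=\frac{x^{t/b}(1-x)^{(1-t)/b}}{B\left(\frac tb+1,\frac{1-t}b+1\right)}I_{[0,1]}(x),$$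 where $B(\cdot,\cdot)$ is the beta function. Theorem. Let $4\le p<\infty$, $0<\beta\le2$ and $L>0$. Then for every sequence $(b_n)_{n\in\mathbb{N}}$ in $(0,1)$, $$\liminf_{n\to\infty}\frac{R_n(\hat f_{b_n},\beta,L)}{r_n(\beta,L)}=\infty .$$ -/

import Mathlib

open MeasureTheory Set Filter

noncomputable section

namespace BetaKernel

/-- The largest natural number that is strictly smaller than `β`
(the set below is nonempty and bounded when `0 < β`). -/
def holderOrder (β : ℝ) : ℕ := sSup {l : ℕ | (l : ℝ) < β}

/-- The class `Σ(β, L)` of the probability densities on `[0, 1]` that are `m` times differentiable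
on `[0, 1]` (one-sided at the end points) with an `m`-th derivative that is Hölder of exponent
`β - m` with constant `L`, where `m` is the largest natural number strictly below `β`.
A density on `[0, 1]` is represented by a function on `ℝ`, of which only the values
on `[0, 1]` matter, here and in everything below. -/
structure IsHolderDensity (β L : ℝ) (f : ℝ → ℝ) : Prop where
  nonneg : ∀ x ∈ Icc (0 : ℝ) 1, 0 ≤ f x
  integral_eq_one : ∫ x in Icc (0 : ℝ) 1, f x = 1
  differentiable : ∀ l < holderOrder β,
    DifferentiableOn ℝ (iteratedDerivWithin l f (Icc 0 1)) (Icc 0 1)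
  holder : ∀ x ∈ Icc (0 : ℝ) 1, ∀ y ∈ Icc (0 : ℝ) 1,
    |iteratedDerivWithin (holderOrder β) f (Icc 0 1) x -
      iteratedDerivWithin (holderOrder β) f (Icc 0 1) y| ≤ L * |x - y| ^ (β - holderOrder β)

/-- The law on `ℝ` of one observation with density `f` with respect to Lebesgue measure
on `[0, 1]`. -/
def law (f : ℝ → ℝ) : Measure ℝ :=
  (volume.restrict (Icc (0 : ℝ) 1)).withDensity fun x => ENNReal.ofReal (f x)

/-- The law of an i.i.d. sample `(X₁, …, Xₙ)` of density `f`. -/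
def sampleLaw (n : ℕ) (f : ℝ → ℝ) : Measure (Fin n → ℝ) := Measure.pi fun _ => law f

/-- The risk `(E_fⁿ ‖T - f‖_p ^ p) ^ (1 / p)`, with the `L^p` norm on `[0, 1]`,
of an estimator `T` (a function of the sample with values in the functions of `t`). -/
def risk (p : ℝ) (n : ℕ) (T : (Fin n → ℝ) → ℝ → ℝ) (f : ℝ → ℝ) : ENNReal :=
  (∫⁻ X, (∫⁻ t in Icc (0 : ℝ) 1, ENNReal.ofReal |T X t - f t| ^ p) ∂(sampleLaw n f)) ^ (1 / p)

/-- The maximal risk over the Hölder class. -/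
def maxRisk (p : ℝ) (n : ℕ) (T : (Fin n → ℝ) → ℝ → ℝ) (β L : ℝ) : ENNReal :=
  ⨆ (f : ℝ → ℝ) (_ : IsHolderDensity β L f), risk p n T f

/-- The minimax risk `r_n(β, L)`: the infimum of the maximal risk over all estimators, that is,
over all (jointly) measurable functions of the sample and of the point `t`. -/
def minimaxRisk (p : ℝ) (n : ℕ) (β L : ℝ) : ENNReal :=
  ⨅ (T : (Fin n → ℝ) → ℝ → ℝ) (_ : Measurable (Function.uncurry T)), maxRisk p n T β L

/-- The beta kernel `K_{t,b}`: the density of the beta distribution with parameters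
`t / b + 1` and `(1 - t) / b + 1`. -/
def kernel (t b x : ℝ) : ℝ :=
  (Icc (0 : ℝ) 1).indicator
    (fun x => x ^ (t / b) * (1 - x) ^ ((1 - t) / b) /
      ProbabilityTheory.beta (t / b + 1) ((1 - t) / b + 1)) x

/-- The beta kernel estimator with bandwidth `b`. -/
def estimator (b : ℝ) (n : ℕ) (X : Fin n → ℝ) (t : ℝ) : ℝ :=
  1 / (n : ℝ) * ∑ k, kernel t b (X k)

end BetaKernel

end

/-!
# The beta kernel estimator is not rate optimal for `p ≥ 4`

The minimax risk over the Hölder class is at most of order `r = n ^ (-β / (2 β + 1))`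
(`exists_minimaxRisk_le`), while the maximal risk of the beta kernel estimator is of larger order
than `r` for every choice of bandwidths (`eventually_le_maxRisk`).

The upper bound comes from a kernel estimator whose window of length `h = n ^ (-1 / (2 β + 1))` lies
on one side of `t`, to the right for `t ≤ 1 / 2` and to the left otherwise, and whose kernel
reproduces affine functions. Its bias is of order `h ^ β = r`, since a Hölder density is affine up
to `O(|x - t| ^ β)` (`IsHolderDensity.exists_slope`). Its stochastic error is a sum of bounded
independent variables, whose exponential moments bound the moment of order `p`
(`lintegral_abs_sum_rpow_le`).

For the lower bound, the moments of the beta distribution are explicit. They enter in two ways.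

* At the uniform density the estimator is unbiased, and Jensen's inequality bounds the risk from
  below by the standard deviation. The variance at `t ≥ b` is at least of order `n⁻¹ (b t) ^ (-1/2)`
  (`le_setIntegral_kernel_sq_sub_one`). Its power `p / 2` is at least of order
  `(n √b) ^ (-p / 2) t⁻¹` when `p ≥ 4`, and integrating over `t ∈ [b, 1]` produces the factor
  `log (1 / b)` (`ofReal_log_le_rpow_maxRisk`).
* The bias is of order at least `b ^ (β / 2)` for some density of the class
  (`exists_rpow_le_maxRisk`). For small `b` the densities `1 + a cos (2 π k x)` and
  `1 + a sin (2 π k x)` with `k` of order `b ^ (-1 / 2)` and `a` of order `k ^ (-β)` are used; one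
  of the two has a bias of order `a`, because the mean of `1 - cos (2 π k (X - t))` is bounded below
  when `X` has density `K_{t,b}`. For the other `b` an affine density suffices.

If `b ^ (β / 2)` is not already large compared with `r`, then `b` is `O(n ^ (-2 / (2 β + 1)))`, so
`(n √b) ^ (-1 / 2)` is at least of order `r` and `log (1 / b)` tends to infinity.
-/

noncomputable section

namespace BetaKernel

/-! ### Hölder densities -/

lemma holderOrder_eq_zero {β : ℝ} (h0 : 0 < β) (h1 : β ≤ 1) : holderOrder β = 0 := by
  have : {l : ℕ | (l : ℝ) < β} = {0} := by
    ext l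
    simp only [mem_ofPred_eq, mem_singleton_iff]
    constructor
    · intro h
      have : (l : ℝ) < 1 := h.trans_le h1
      exact_mod_cast Nat.lt_one_iff.mp (by exact_mod_cast this)
    · rintro rfl
      simpa using h0
  rw [holderOrder, this, csSup_singleton]

lemma holderOrder_eq_one {β : ℝ} (h1 : 1 < β) (h2 : β ≤ 2) : holderOrder β = 1 := by
  have : {l : ℕ | (l : ℝ) < β} = Iic 1 := by
    ext l
    simp only [mem_ofPred_eq, mem_Iic]
    constructor
    · intro h
      have : (l : ℝ) < 2 := h.trans_le h2
      have : l < 2 := by exact_mod_cast this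
      omega
    · intro h
      have : (l : ℝ) ≤ 1 := by exact_mod_cast h
      linarith
  rw [holderOrder, this, csSup_Iic]

/-- A Hölder density is approximated at each point by an affine function up to order `β`; the slope
is zero for `β ≤ 1` and the derivative of the density otherwise. -/
lemma IsHolderDensity.exists_slope {β L : ℝ} {f : ℝ → ℝ} (hf : IsHolderDensity β L f)
    (hβ : 0 < β) (hβ2 : β ≤ 2) {t : ℝ} (ht : t ∈ Icc (0 : ℝ) 1) :
    ∃ s : ℝ, ∀ x ∈ Icc (0 : ℝ) 1, |f x - f t - s * (x - t)| ≤ L * |x - t| ^ β := by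
  rcases le_or_gt β 1 with h1 | h1
  · refine ⟨0, fun x hx => ?_⟩
    have := hf.holder x hx t ht
    rw [holderOrder_eq_zero hβ h1] at this
    simpa using this
  · have hm := holderOrder_eq_one h1 hβ2
    have hd : DifferentiableOn ℝ f (Icc 0 1) := by
      simpa using hf.differentiable 0 (by rw [hm]; exact one_pos)
    have hh := hf.holder
    rw [hm] at hh
    simp only [iteratedDerivWithin_one, Nat.cast_one] at hh
    refine ⟨derivWithin f (Icc 0 1) t, fun x hx => ?_⟩
    have hsub : uIcc t x ⊆ Icc (0 : ℝ) 1 := (convex_Icc 0 1).ordConnected.uIcc_subset ht hx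
    have hder : ∀ y ∈ uIcc t x, HasDerivWithinAt
        (fun y => f y - derivWithin f (Icc 0 1) t * y)
        (derivWithin f (Icc 0 1) y - derivWithin f (Icc 0 1) t) (uIcc t x) y := fun y hy => by
      have h2 := ((hd y (hsub hy)).hasDerivWithinAt).mono hsub
      simpa using h2.fun_sub ((hasDerivWithinAt_id y (uIcc t x)).const_mul (derivWithin f (Icc 0 1) t))
    have hL : 0 ≤ L := by
      have := hh 0 (by simp) 1 (by simp)
      have h3 := (abs_nonneg _).trans this
      simpa using h3
    have hbound : ∀ y ∈ uIcc t x,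
        ‖derivWithin f (Icc 0 1) y - derivWithin f (Icc 0 1) t‖ ≤ L * |x - t| ^ (β - 1) := by
      intro y hy
      refine (hh y (hsub hy) t ht).trans ?_
      have : |y - t| ≤ |x - t| := abs_sub_left_of_mem_uIcc hy
      gcongr
    have := (convex_uIcc t x).norm_image_sub_le_of_norm_hasDerivWithin_le hder hbound
      left_mem_uIcc right_mem_uIcc
    rw [Real.norm_eq_abs, Real.norm_eq_abs, mul_assoc] at this
    have hpow : |x - t| ^ (β - 1) * |x - t| = |x - t| ^ β := by
      conv_rhs => rw [show β = (β - 1) + 1 by ring,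
        Real.rpow_add' (abs_nonneg _) (by linarith), Real.rpow_one]
    rw [hpow] at this
    convert this using 2
    ring

lemma IsHolderDensity.continuousOn {β L : ℝ} {f : ℝ → ℝ} (hf : IsHolderDensity β L f)
    (hβ : 0 < β) (hβ2 : β ≤ 2) : ContinuousOn f (Icc 0 1) := by
  intro t ht
  obtain ⟨s, hs⟩ := hf.exists_slope hβ hβ2 ht
  rw [ContinuousWithinAt, tendsto_iff_norm_sub_tendsto_zero]
  have hlim : Tendsto (fun x => L * |x - t| ^ β + |s * (x - t)|) (nhdsWithin t (Icc 0 1))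
      (nhds 0) := by
    have : Continuous fun x => L * |x - t| ^ β + |s * (x - t)| := by
      have := hβ.le
      fun_prop (disch := assumption)
    have h2 := (this.tendsto t).mono_left (nhdsWithin_le_nhds (s := Icc 0 1))
    simpa [hβ.ne'] using h2
  refine tendsto_of_tendsto_of_tendsto_of_le_of_le' tendsto_const_nhds hlim
    (Eventually.of_forall fun _ => norm_nonneg _) ?_
  filter_upwards [self_mem_nhdsWithin] with x hx
  have h1 := hs x hx
  have h2 := abs_add_le (f x - f t - s * (x - t)) (s * (x - t))
  rw [Real.norm_eq_abs]
  rw [sub_add_cancel] at h2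
  linarith

lemma IsHolderDensity.integrableOn {β L : ℝ} {f : ℝ → ℝ} (hf : IsHolderDensity β L f)
    (hβ : 0 < β) (hβ2 : β ≤ 2) : IntegrableOn f (Icc 0 1) :=
  (hf.continuousOn hβ hβ2).integrableOn_Icc

/-- The densities of a Hölder class are uniformly bounded: an affine function that is at least `-L`
on `[0, 1]` and has integral at most `1 + L` is bounded. -/
lemma IsHolderDensity.le_bound {β L : ℝ} {f : ℝ → ℝ} (hf : IsHolderDensity β L f)
    (hβ : 0 < β) (hβ2 : β ≤ 2) (hL : 0 < L) {x : ℝ} (hx : x ∈ Icc (0 : ℝ) 1) :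
    f x ≤ 2 + 4 * L := by
  obtain ⟨s, hs⟩ := hf.exists_slope hβ hβ2 (t := 0) (by simp)
  have hs' : ∀ x ∈ Icc (0 : ℝ) 1, |f x - f 0 - s * x| ≤ L := by
    intro x hx
    have h1 := hs x hx
    simp only [sub_zero] at h1
    refine h1.trans ?_
    have : |x| ^ β ≤ 1 := Real.rpow_le_one (abs_nonneg _) (by rw [abs_of_nonneg hx.1]; exact hx.2)
      hβ.le
    nlinarith
  have hint : ∫ x in Icc (0 : ℝ) 1, (f 0 + s * x - L) ≤ ∫ x in Icc (0 : ℝ) 1, f x := by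
    refine setIntegral_mono_on ?_ (hf.integrableOn hβ hβ2) measurableSet_Icc ?_
    · exact (Continuous.continuousOn (by fun_prop)).integrableOn_Icc
    · intro x hx
      have := (abs_le.mp (hs' x hx)).1
      linarith
  have hval : ∫ x in Icc (0 : ℝ) 1, (f 0 + s * x - L) = f 0 + s / 2 - L := by
    rw [integral_Icc_eq_integral_Ioc, ← intervalIntegral.integral_of_le zero_le_one,
      intervalIntegral.integral_sub, intervalIntegral.integral_add,
      intervalIntegral.integral_const_mul, integral_id]
    · simp; ring
    all_goals exact Continuous.intervalIntegrable (by fun_prop) _ _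
  rw [hval, hf.integral_eq_one] at hint
  have h0 := hf.nonneg 0 (by simp)
  have h1 := hf.nonneg 1 (by simp)
  have h1' := (abs_le.mp (hs' 1 (by simp))).2
  have hx' := (abs_le.mp (hs' x hx)).2
  obtain ⟨hx0, hx1⟩ := hx
  rcases le_or_gt 0 s with h | h
  · nlinarith
  · nlinarith

/-- A criterion for differentiable functions to belong to a Hölder class. -/
lemma isHolderDensity_of_hasDerivAt {β L : ℝ} {f f' : ℝ → ℝ} (hβ : 0 < β) (hβ2 : β ≤ 2)
    (hpos : ∀ x ∈ Icc (0 : ℝ) 1, 0 ≤ f x) (hint : ∫ x in Icc (0 : ℝ) 1, f x = 1)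
    (hd : ∀ x, HasDerivAt f (f' x) x)
    (h0 : β ≤ 1 → ∀ x ∈ Icc (0 : ℝ) 1, ∀ y ∈ Icc (0 : ℝ) 1, |f x - f y| ≤ L * |x - y| ^ β)
    (h1 : 1 < β → ∀ x ∈ Icc (0 : ℝ) 1, ∀ y ∈ Icc (0 : ℝ) 1,
      |f' x - f' y| ≤ L * |x - y| ^ (β - 1)) : IsHolderDensity β L f := by
  rcases le_or_gt β 1 with h | h
  · have hm := holderOrder_eq_zero hβ h
    refine ⟨hpos, hint, fun l hl => ?_, fun x hx y hy => ?_⟩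
    · rw [hm] at hl; omega
    · simpa [hm] using h0 h x hx y hy
  · have hm := holderOrder_eq_one h hβ2
    refine ⟨hpos, hint, fun l hl => ?_, fun x hx y hy => ?_⟩
    · rw [hm, Nat.lt_one_iff] at hl
      subst hl
      rw [iteratedDerivWithin_zero]
      exact fun x _ => (hd x).differentiableAt.differentiableWithinAt
    · have hdw : ∀ x ∈ Icc (0 : ℝ) 1, derivWithin f (Icc 0 1) x = f' x := fun x hx =>
        (hd x).hasDerivWithinAt.derivWithin (uniqueDiffOn_Icc zero_lt_one x hx)
      simpa [hm, iteratedDerivWithin_one, hdw x hx, hdw y hy] using h1 h x hx y hy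

lemma isHolderDensity_affine {β L a : ℝ} (hβ : 0 < β) (hβ2 : β ≤ 2) (ha : 0 ≤ a) (ha1 : a ≤ 1)
    (haL : a ≤ L) : IsHolderDensity β L fun x => 1 + a * (x - 1 / 2) := by
  refine isHolderDensity_of_hasDerivAt (f' := fun _ => a) hβ hβ2 ?_ ?_ ?_ ?_ ?_
  · intro x hx
    have := hx.1
    nlinarith
  · rw [integral_Icc_eq_integral_Ioc, ← intervalIntegral.integral_of_le zero_le_one,
      intervalIntegral.integral_add, intervalIntegral.integral_const_mul,
      intervalIntegral.integral_sub, integral_id]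
    · simp
    all_goals exact Continuous.intervalIntegrable (by fun_prop) _ _
  · intro x
    simpa using (((hasDerivAt_id x).sub_const (1 / 2 : ℝ)).const_mul a).const_add (1 : ℝ)
  · intro h x hx y hy
    have h1 : (1 + a * (x - 1 / 2)) - (1 + a * (y - 1 / 2)) = a * (x - y) := by ring
    rw [h1, abs_mul, abs_of_nonneg ha]
    have h2 : |x - y| ≤ 1 := by
      rw [abs_le]; constructor <;> linarith [hx.1, hx.2, hy.1, hy.2]
    have h3 : |x - y| ≤ |x - y| ^ β := by
      simpa using Real.rpow_le_rpow_of_exponent_ge' (abs_nonneg _) h2 hβ.le h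
    have h4 : 0 ≤ L := ha.trans haL
    gcongr
  · intro _ x _ y _
    simp only [sub_self, abs_zero]
    have : 0 ≤ L := ha.trans haL
    positivity

/-- A function that is bounded by `1` and `w`-Lipschitz is Hölder of every exponent in `[0, 1]`. -/
lemma abs_sub_le_two_mul_rpow {g : ℝ → ℝ} {w s x y : ℝ} (hw : 0 ≤ w) (hs : 0 ≤ s) (hs1 : s ≤ 1)
    (hb : ∀ x, |g x| ≤ 1) (hl : |g x - g y| ≤ w * |x - y|) :
    |g x - g y| ≤ 2 * (w * |x - y|) ^ s := by
  have h2 : |g x - g y| ≤ 2 := (abs_sub _ _).trans (by linarith [hb x, hb y])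
  rcases le_or_gt (w * |x - y|) 1 with h | h
  · have : w * |x - y| ≤ (w * |x - y|) ^ s := by
      simpa using Real.rpow_le_rpow_of_exponent_ge' (by positivity) h hs hs1
    have : 0 ≤ w * |x - y| := by positivity
    linarith
  · have := Real.one_le_rpow h.le hs
    linarith

/-- Oscillations of frequency `w` and amplitude of order `w ^ (-β)` about the uniform density belong
to the Hölder class. -/
lemma isHolderDensity_oscillation {β L a w : ℝ} {g g' : ℝ → ℝ} (hβ : 0 < β) (hβ2 : β ≤ 2)
    (ha : 0 ≤ a) (ha1 : a ≤ 1) (hw : 0 < w) (haL : 2 * a * w ^ β ≤ L)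
    (hg : ∀ x, |g x| ≤ 1) (hg' : ∀ x, |g' x| ≤ 1)
    (hd : ∀ x, HasDerivAt g (w * g' x) x) (hlip : ∀ x y, |g x - g y| ≤ w * |x - y|)
    (hlip' : ∀ x y, |g' x - g' y| ≤ w * |x - y|)
    (hint : ∫ x in Icc (0 : ℝ) 1, g x = 0) :
    IsHolderDensity β L fun x => 1 + a * g x := by
  have hc : Continuous g := continuous_iff_continuousAt.mpr fun x => (hd x).continuousAt
  refine isHolderDensity_of_hasDerivAt (f' := fun x => a * (w * g' x)) hβ hβ2 ?_ ?_ ?_ ?_ ?_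
  · intro x _
    have := (abs_le.mp (hg x)).1
    nlinarith
  · rw [integral_add, integral_const_mul, hint]
    · simp
    · exact integrable_const _
    · exact Continuous.integrableOn_Icc (by fun_prop)
  · intro x
    exact ((hd x).const_mul a).const_add 1
  · intro h x _ y _
    have h1 : (1 + a * g x) - (1 + a * g y) = a * (g x - g y) := by ring
    rw [h1, abs_mul, abs_of_nonneg ha]
    have h2 := abs_sub_le_two_mul_rpow hw.le hβ.le h hg (hlip x y)
    rw [Real.mul_rpow hw.le (abs_nonneg _)] at h2
    calc a * |g x - g y| ≤ a * (2 * (w ^ β * |x - y| ^ β)) := by gcongr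
      _ = (2 * a * w ^ β) * |x - y| ^ β := by ring
      _ ≤ _ := by gcongr
  · intro h x _ y _
    have h1 : a * (w * g' x) - a * (w * g' y) = a * w * (g' x - g' y) := by ring
    rw [h1, abs_mul, abs_of_nonneg (by positivity : 0 ≤ a * w)]
    have h2 := abs_sub_le_two_mul_rpow hw.le (by linarith : 0 ≤ β - 1) (by linarith) hg' (hlip' x y)
    rw [Real.mul_rpow hw.le (abs_nonneg _)] at h2
    have h3 : w ^ β = w * w ^ (β - 1) := by
      rw [Real.rpow_sub_one hw.ne']; field_simp
    calc a * w * |g' x - g' y| ≤ a * w * (2 * (w ^ (β - 1) * |x - y| ^ (β - 1))) := by gcongr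
      _ = (2 * a * w ^ β) * |x - y| ^ (β - 1) := by rw [h3]; ring
      _ ≤ _ := by gcongr

lemma abs_cos_sub_cos_le (x y : ℝ) : |Real.cos x - Real.cos y| ≤ |x - y| := by
  have := Real.lipschitzWith_cos.dist_le_mul x y
  simpa [Real.dist_eq] using this

lemma abs_sin_sub_sin_le (x y : ℝ) : |Real.sin x - Real.sin y| ≤ |x - y| := by
  have := Real.lipschitzWith_sin.dist_le_mul x y
  simpa [Real.dist_eq] using this

lemma isHolderDensity_cos {β L a : ℝ} {k : ℕ} (hk : k ≠ 0) (hβ : 0 < β) (hβ2 : β ≤ 2) (ha : 0 ≤ a)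
    (ha1 : a ≤ 1) (haL : 2 * a * (2 * Real.pi * k) ^ β ≤ L) :
    IsHolderDensity β L fun x => 1 + a * Real.cos (2 * Real.pi * k * x) := by
  have hk' : 0 < (k : ℝ) := by positivity
  have hw : 0 < 2 * Real.pi * k := by positivity
  have hmul : ∀ x y, |2 * Real.pi * k * x - 2 * Real.pi * k * y| = 2 * Real.pi * k * |x - y| :=
    fun x y => by rw [← mul_sub, abs_mul, abs_of_pos hw]
  refine isHolderDensity_oscillation (g := fun x => Real.cos (2 * Real.pi * k * x))
    (g' := fun x => -Real.sin (2 * Real.pi * k * x)) hβ hβ2 ha ha1 hw haL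
    (fun x => Real.abs_cos_le_one _) (fun x => by rw [abs_neg]; exact Real.abs_sin_le_one _)
    (fun x => ?_) (fun x y => (abs_cos_sub_cos_le _ _).trans_eq (hmul x y)) (fun x y => ?_) ?_
  · have := ((hasDerivAt_id x).const_mul (2 * Real.pi * k)).cos
    convert! this using 1
    simp; ring
  · rw [show -Real.sin (2 * Real.pi * k * x) - -Real.sin (2 * Real.pi * k * y) =
      Real.sin (2 * Real.pi * k * y) - Real.sin (2 * Real.pi * k * x) by ring, abs_sub_comm x y]
    exact (abs_sin_sub_sin_le _ _).trans_eq (hmul y x)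
  · rw [integral_Icc_eq_integral_Ioc, ← intervalIntegral.integral_of_le zero_le_one,
      intervalIntegral.integral_comp_mul_left _ hw.ne', integral_cos]
    have : Real.sin (2 * Real.pi * k) = 0 := by
      rw [show 2 * Real.pi * k = ((2 * k : ℕ) : ℝ) * Real.pi by push_cast; ring]
      exact Real.sin_nat_mul_pi _
    simp [this]

lemma isHolderDensity_sin {β L a : ℝ} {k : ℕ} (hk : k ≠ 0) (hβ : 0 < β) (hβ2 : β ≤ 2) (ha : 0 ≤ a)
    (ha1 : a ≤ 1) (haL : 2 * a * (2 * Real.pi * k) ^ β ≤ L) :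
    IsHolderDensity β L fun x => 1 + a * Real.sin (2 * Real.pi * k * x) := by
  have hk' : 0 < (k : ℝ) := by positivity
  have hw : 0 < 2 * Real.pi * k := by positivity
  have hmul : ∀ x y, |2 * Real.pi * k * x - 2 * Real.pi * k * y| = 2 * Real.pi * k * |x - y| :=
    fun x y => by rw [← mul_sub, abs_mul, abs_of_pos hw]
  refine isHolderDensity_oscillation (g := fun x => Real.sin (2 * Real.pi * k * x))
    (g' := fun x => Real.cos (2 * Real.pi * k * x)) hβ hβ2 ha ha1 hw haL
    (fun x => Real.abs_sin_le_one _) (fun x => Real.abs_cos_le_one _)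
    (fun x => ?_) (fun x y => (abs_sin_sub_sin_le _ _).trans_eq (hmul x y))
    (fun x y => (abs_cos_sub_cos_le _ _).trans_eq (hmul x y)) ?_
  · have := ((hasDerivAt_id x).const_mul (2 * Real.pi * k)).sin
    convert! this using 1
    simp; ring
  · rw [integral_Icc_eq_integral_Ioc, ← intervalIntegral.integral_of_le zero_le_one,
      intervalIntegral.integral_comp_mul_left _ hw.ne', integral_sin]
    have : Real.cos (2 * Real.pi * k) = 1 := by
      rw [show 2 * Real.pi * k = (k : ℝ) * (2 * Real.pi) by ring]
      exact Real.cos_nat_mul_two_pi _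
    simp [this]

/-! ### Risks and moments of sample means -/

lemma IsHolderDensity.aemeasurable {β L : ℝ} {f : ℝ → ℝ} (hf : IsHolderDensity β L f)
    (hβ : 0 < β) (hβ2 : β ≤ 2) : AEMeasurable f (volume.restrict (Icc 0 1)) :=
  (hf.continuousOn hβ hβ2).aemeasurable measurableSet_Icc

lemma IsHolderDensity.isProbabilityMeasure_law {β L : ℝ} {f : ℝ → ℝ} (hf : IsHolderDensity β L f)
    (hβ : 0 < β) (hβ2 : β ≤ 2) : IsProbabilityMeasure (law f) := by
  constructor
  rw [law, withDensity_apply _ MeasurableSet.univ, Measure.restrict_univ,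
    ← ofReal_integral_eq_lintegral_ofReal (hf.integrableOn hβ hβ2), hf.integral_eq_one,
    ENNReal.ofReal_one]
  exact ae_restrict_of_forall_mem measurableSet_Icc hf.nonneg

lemma IsHolderDensity.integral_law {β L : ℝ} {f : ℝ → ℝ} (hf : IsHolderDensity β L f)
    (hβ : 0 < β) (hβ2 : β ≤ 2) (g : ℝ → ℝ) :
    ∫ x, g x ∂(law f) = ∫ x in Icc (0 : ℝ) 1, f x * g x := by
  rw [law, integral_withDensity_eq_integral_toReal_smul₀
    (hf.aemeasurable hβ hβ2).ennreal_ofReal (by simp)]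
  refine setIntegral_congr_fun measurableSet_Icc fun x hx => ?_
  simp [ENNReal.toReal_ofReal (hf.nonneg x hx)]

/-- The estimator `t ↦ n⁻¹ ∑ G(t, X_k)` attached to a kernel `G`. The beta kernel estimator
`estimator b n` is definitionally the case `G(t, x) = kernel t b x`. -/
def kernelEstimator (G : ℝ → ℝ → ℝ) (n : ℕ) (X : Fin n → ℝ) (t : ℝ) : ℝ :=
  1 / (n : ℝ) * ∑ k, G t (X k)

/-- Tonelli's theorem for the risk. -/
lemma rpow_risk_eq {p β L : ℝ} {n : ℕ} {T : (Fin n → ℝ) → ℝ → ℝ} {f : ℝ → ℝ} (hp : 0 < p)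
    (hβ : 0 < β) (hβ2 : β ≤ 2) (hf : IsHolderDensity β L f)
    (hT : AEMeasurable (Function.uncurry T) ((sampleLaw n f).prod (volume.restrict (Icc 0 1)))) :
    risk p n T f ^ p =
      ∫⁻ t in Icc (0 : ℝ) 1, ∫⁻ X, ENNReal.ofReal |T X t - f t| ^ p ∂(sampleLaw n f) := by
  have := hf.isProbabilityMeasure_law hβ hβ2
  have : IsProbabilityMeasure (sampleLaw n f) := by unfold sampleLaw; infer_instance
  rw [risk, ← ENNReal.rpow_mul, one_div_mul_cancel hp.ne', ENNReal.rpow_one,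
    lintegral_lintegral_swap]
  have h1 : AEMeasurable (fun z : (Fin n → ℝ) × ℝ => T z.1 z.2 - f z.2)
      ((sampleLaw n f).prod (volume.restrict (Icc 0 1))) :=
    hT.sub (hf.aemeasurable hβ hβ2).comp_snd
  have h2 : AEMeasurable (fun z : (Fin n → ℝ) × ℝ => |T z.1 z.2 - f z.2|)
      ((sampleLaw n f).prod (volume.restrict (Icc 0 1))) := measurable_norm.comp_aemeasurable h1
  exact h2.ennreal_ofReal.pow_const p

section Moments

variable {Ω : Type*} [MeasurableSpace Ω]

lemma ofReal_abs_integral_rpow_le {P : Measure Ω} [IsProbabilityMeasure P] {Z : Ω → ℝ} {p : ℝ}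
    (hp : 1 ≤ p) (hZ : AEStronglyMeasurable Z P) :
    ENNReal.ofReal |∫ ω, Z ω ∂P| ^ p ≤ ∫⁻ ω, ENNReal.ofReal |Z ω| ^ p ∂P := by
  have h1 : ENNReal.ofReal |∫ ω, Z ω ∂P| ≤ eLpNorm' Z 1 P := by
    rw [eLpNorm'_eq_lintegral_enorm]
    simp only [ENNReal.rpow_one, div_one]
    have := enorm_integral_le_lintegral_enorm (μ := P) Z
    rwa [Real.enorm_eq_ofReal_abs] at this
  have h2 := eLpNorm'_le_eLpNorm'_of_exponent_le zero_lt_one hp P hZ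
  have h3 : eLpNorm' Z p P ^ p = ∫⁻ ω, ENNReal.ofReal |Z ω| ^ p ∂P := by
    rw [eLpNorm'_eq_lintegral_enorm, ← ENNReal.rpow_mul, one_div_mul_cancel (by linarith),
      ENNReal.rpow_one]
    simp_rw [Real.enorm_eq_ofReal_abs]
  rw [← h3]
  exact ENNReal.rpow_le_rpow (h1.trans h2) (by linarith)

lemma ofReal_integral_sq_rpow_le {P : Measure Ω} [IsProbabilityMeasure P] {Z : Ω → ℝ} {p : ℝ}
    (hp : 2 ≤ p) (hZ : AEStronglyMeasurable Z P) :
    ENNReal.ofReal (∫ ω, Z ω ^ 2 ∂P) ^ (p / 2) ≤ ∫⁻ ω, ENNReal.ofReal |Z ω| ^ p ∂P := by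
  have h := ofReal_abs_integral_rpow_le (P := P) (Z := fun ω => Z ω ^ 2) (p := p / 2)
    (by linarith) (hZ.pow 2)
  rw [abs_of_nonneg (integral_nonneg fun _ => sq_nonneg _)] at h
  refine h.trans_eq (lintegral_congr fun ω => ?_)
  rw [abs_of_nonneg (sq_nonneg _), ← sq_abs, ENNReal.ofReal_pow (abs_nonneg _),
    ← ENNReal.rpow_natCast, ← ENNReal.rpow_mul]
  congr 1
  push_cast
  ring

lemma integral_average {μ : Measure ℝ} [IsProbabilityMeasure μ] {n : ℕ} (hn : n ≠ 0) {g : ℝ → ℝ}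
    (hg : Integrable g μ) :
    ∫ X : Fin n → ℝ, 1 / (n : ℝ) * ∑ k, g (X k) ∂(Measure.pi fun _ => μ) = ∫ x, g x ∂μ := by
  rw [integral_const_mul, integral_finsetSum]
  · simp_rw [integral_comp_eval (μ := fun _ : Fin n => μ) hg.aestronglyMeasurable]
    have : (n : ℝ) ≠ 0 := by exact_mod_cast hn
    simp
    field_simp
  · intro i _
    exact integrable_comp_eval (μ := fun _ : Fin n => μ) hg

lemma integral_average_sub_sq {μ : Measure ℝ} [IsProbabilityMeasure μ] {n : ℕ} (hn : n ≠ 0)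
    {g : ℝ → ℝ} (hg : MemLp g 2 μ) :
    ∫ X : Fin n → ℝ, (1 / (n : ℝ) * ∑ k, g (X k) - ∫ x, g x ∂μ) ^ 2 ∂(Measure.pi fun _ => μ) =
      1 / n * (∫ x, g x ^ 2 ∂μ - (∫ x, g x ∂μ) ^ 2) := by
  have hn' : (n : ℝ) ≠ 0 := by exact_mod_cast hn
  have h1 := ProbabilityTheory.variance_sum_pi (μ := fun _ : Fin n => μ) (X := fun _ => g)
    (fun _ => hg)
  have hint := hg.integrable one_le_two
  have hm := integral_average (μ := μ) hn hint
  have hme : ∀ k : Fin n, AEStronglyMeasurable (fun X : Fin n → ℝ => g (X k))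
      (Measure.pi fun _ => μ) := fun k =>
    (integrable_comp_eval (μ := fun _ : Fin n => μ) hint).aestronglyMeasurable
  have h2 : ProbabilityTheory.variance (fun X : Fin n → ℝ => 1 / (n : ℝ) * ∑ k, g (X k))
      (Measure.pi fun _ => μ) = 1 / n * (∫ x, g x ^ 2 ∂μ - (∫ x, g x ∂μ) ^ 2) := by
    rw [ProbabilityTheory.variance_const_mul]
    have h3 : (fun X : Fin n → ℝ => ∑ k, g (X k)) = ∑ k : Fin n, fun X : Fin n → ℝ => g (X k) := by
      ext X; simp
    rw [h3, h1, ProbabilityTheory.variance_eq_sub hg]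
    simp
    field_simp
  rw [← h2, ProbabilityTheory.variance_eq_integral, hm]
  exact ((Finset.aestronglyMeasurable_fun_sum _ fun k _ => hme k).const_mul _).aemeasurable

lemma rpow_le_rpow_mul_exp {p y : ℝ} (hp : 0 < p) (hy : 0 ≤ y) : y ^ p ≤ p ^ p * Real.exp y := by
  have h1 : y / p ≤ Real.exp (y / p) := by
    have := Real.add_one_le_exp (y / p)
    linarith
  have h2 := Real.rpow_le_rpow (by positivity) h1 hp.le
  rw [← Real.exp_mul, Real.div_rpow hy hp.le, div_mul_cancel₀ _ hp.ne',
    div_le_iff₀ (by positivity)] at h2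
  linarith

lemma exp_le_one_add_add_sq {x : ℝ} (hx : |x| ≤ 1) : Real.exp x ≤ 1 + x + x ^ 2 := by
  have := Real.abs_exp_sub_one_sub_id_le hx
  linarith [(abs_le.mp this).2]

lemma integral_exp_sum_le {μ : Measure ℝ} [IsProbabilityMeasure μ] {n : ℕ} {U : ℝ → ℝ} {l M v : ℝ}
    (hU : Measurable U) (hM : ∀ x, |U x| ≤ M) (h0 : ∫ x, U x ∂μ = 0) (hv : ∫ x, U x ^ 2 ∂μ ≤ v)
    (hl : |l| * M ≤ 1) (hlv : n * (l ^ 2 * v) ≤ 1) :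
    ∫ X : Fin n → ℝ, Real.exp (l * ∑ k, U (X k)) ∂(Measure.pi fun _ => μ) ≤ Real.exp 1 := by
  have hbd : ∀ x, |l * U x| ≤ 1 := fun x => by
    rw [abs_mul]
    exact (mul_le_mul_of_nonneg_left (hM x) (abs_nonneg _)).trans hl
  have hUi : Integrable U μ := Integrable.of_bound hU.aestronglyMeasurable M
    (Eventually.of_forall hM)
  have hU2 : Integrable (fun x => U x ^ 2) μ :=
    Integrable.of_bound (hU.pow_const 2).aestronglyMeasurable (M ^ 2)
      (Eventually.of_forall fun x => by
        rw [Real.norm_eq_abs, abs_pow]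
        exact pow_le_pow_left₀ (abs_nonneg _) (hM x) 2)
  have hexp : Integrable (fun x => Real.exp (l * U x)) μ :=
    Integrable.of_bound (hU.const_mul l).exp.aestronglyMeasurable (Real.exp 1)
      (Eventually.of_forall fun x => by
        rw [Real.norm_eq_abs, Real.abs_exp]
        exact Real.exp_le_exp.mpr (abs_le.mp (hbd x)).2)
  have h1 : ∫ x, Real.exp (l * U x) ∂μ ≤ 1 + l ^ 2 * v := by
    calc ∫ x, Real.exp (l * U x) ∂μ ≤ ∫ x, (1 + l * U x + l ^ 2 * U x ^ 2) ∂μ := by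
          refine integral_mono hexp
            (((integrable_const _).fun_add (hUi.const_mul l)).fun_add (hU2.const_mul _)) fun x => ?_
          have := exp_le_one_add_add_sq (hbd x)
          rwa [mul_pow] at this
      _ = 1 + l ^ 2 * ∫ x, U x ^ 2 ∂μ := by
          rw [integral_add ((integrable_const _).fun_add (hUi.const_mul l)) (hU2.const_mul _),
            integral_add (integrable_const _) (hUi.const_mul l), integral_const_mul,
            integral_const_mul, h0]
          simp
      _ ≤ _ := by gcongr
  simp_rw [Finset.mul_sum, Real.exp_sum]
  rw [integral_fintype_prod_eq_pow (fun x => Real.exp (l * U x)), Fintype.card_fin]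
  calc (∫ x, Real.exp (l * U x) ∂μ) ^ n ≤ Real.exp (l ^ 2 * v) ^ n := by
        refine pow_le_pow_left₀ (integral_nonneg fun x => (Real.exp_pos _).le) (h1.trans ?_) n
        linarith [Real.add_one_le_exp (l ^ 2 * v)]
    _ = Real.exp (n * (l ^ 2 * v)) := by rw [← Real.exp_nat_mul]
    _ ≤ _ := Real.exp_le_exp.mpr hlv

/-- The moment of order `p` of a sum of centred bounded i.i.d. variables has the order that the
central limit theorem predicts: for `l = (n v) ^ (-1 / 2)`, which is allowed as soon as `n v`
dominates `M ^ 2`, the exponential moments of `± l ∑ U` are at most `e`, and they control all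
powers. -/
lemma lintegral_abs_sum_rpow_le {μ : Measure ℝ} [IsProbabilityMeasure μ] {n : ℕ} {U : ℝ → ℝ}
    {l M v p : ℝ} (hp : 0 < p) (hU : Measurable U) (hM : ∀ x, |U x| ≤ M) (h0 : ∫ x, U x ∂μ = 0)
    (hv : ∫ x, U x ^ 2 ∂μ ≤ v) (hl0 : 0 < l) (hl : l * M ≤ 1) (hlv : n * (l ^ 2 * v) ≤ 1) :
    ∫⁻ X : Fin n → ℝ, ENNReal.ofReal |∑ k, U (X k)| ^ p ∂(Measure.pi fun _ => μ) ≤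
      ENNReal.ofReal (2 * Real.exp 1 * p ^ p * (l⁻¹) ^ p) := by
  set P : Measure (Fin n → ℝ) := Measure.pi fun _ => μ
  have hS : Measurable fun X : Fin n → ℝ => ∑ k, U (X k) :=
    Finset.measurable_sum _ fun k _ => hU.comp (measurable_pi_apply k)
  have hSb : ∀ X : Fin n → ℝ, |∑ k, U (X k)| ≤ n * M := fun X => by
    refine (Finset.abs_sum_le_sum_abs _ _).trans ((Finset.sum_le_card_nsmul _ _ M
      fun k _ => hM _).trans_eq (by simp))
  have hexp : ∀ c : ℝ, Integrable (fun X : Fin n → ℝ => Real.exp (c * ∑ k, U (X k))) P := fun c =>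
    Integrable.of_bound (hS.const_mul c).exp.aestronglyMeasurable (Real.exp (|c| * (n * M)))
      (Eventually.of_forall fun X => by
        rw [Real.norm_eq_abs, Real.abs_exp]
        refine Real.exp_le_exp.mpr ((le_abs_self _).trans ?_)
        rw [abs_mul]
        exact mul_le_mul_of_nonneg_left (hSb X) (abs_nonneg _))
  have hpt : ∀ X : Fin n → ℝ, ENNReal.ofReal |∑ k, U (X k)| ^ p ≤
      ENNReal.ofReal ((l⁻¹) ^ p * p ^ p *
        (Real.exp (l * ∑ k, U (X k)) + Real.exp (-l * ∑ k, U (X k)))) := fun X => by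
    rw [ENNReal.ofReal_rpow_of_nonneg (abs_nonneg _) hp.le]
    refine ENNReal.ofReal_le_ofReal ?_
    have h1 := rpow_le_rpow_mul_exp hp (y := |l * ∑ k, U (X k)|) (abs_nonneg _)
    have h2 : |∑ k, U (X k)| ^ p = (l⁻¹) ^ p * |l * ∑ k, U (X k)| ^ p := by
      rw [← Real.mul_rpow (by positivity) (abs_nonneg _), abs_mul, abs_of_pos hl0,
        inv_mul_cancel_left₀ hl0.ne']
    rw [h2, mul_assoc]
    refine mul_le_mul_of_nonneg_left (h1.trans ?_) (by positivity)
    refine mul_le_mul_of_nonneg_left ?_ (by positivity)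
    rw [neg_mul]
    exact Real.exp_abs_le _
  have e1 := integral_exp_sum_le (n := n) hU hM h0 hv (by rwa [abs_of_pos hl0]) hlv
  have e2 := integral_exp_sum_le (l := -l) (n := n) hU hM h0 hv (by rwa [abs_neg, abs_of_pos hl0])
    (by rwa [neg_sq])
  refine (lintegral_mono hpt).trans ?_
  rw [← ofReal_integral_eq_lintegral_ofReal (((hexp l).fun_add (hexp (-l))).const_mul _)
    (Eventually.of_forall fun X => by positivity)]
  refine ENNReal.ofReal_le_ofReal ?_
  rw [integral_const_mul, integral_add (hexp l) (hexp (-l))]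
  calc _ ≤ (l⁻¹) ^ p * p ^ p * (Real.exp 1 + Real.exp 1) := by gcongr
    _ = _ := by ring

end Moments

/-- The `p`-th power of the risk of a kernel estimator is at least that of its bias. -/
lemma lintegral_bias_le_rpow_risk {p β L : ℝ} {n : ℕ} {G : ℝ → ℝ → ℝ} {f : ℝ → ℝ} (hp : 1 ≤ p)
    (hβ : 0 < β) (hβ2 : β ≤ 2) (hf : IsHolderDensity β L f) (hn : n ≠ 0)
    (hT : AEMeasurable (Function.uncurry (kernelEstimator G n))
      ((sampleLaw n f).prod (volume.restrict (Icc 0 1))))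
    (hG : ∀ t ∈ Icc (0 : ℝ) 1, Measurable (G t))
    (hGb : ∀ t ∈ Icc (0 : ℝ) 1, ∃ M, ∀ x, |G t x| ≤ M) :
    ∫⁻ t in Icc (0 : ℝ) 1, ENNReal.ofReal |(∫ x in Icc (0 : ℝ) 1, f x * G t x) - f t| ^ p ≤
      risk p n (kernelEstimator G n) f ^ p := by
  have := hf.isProbabilityMeasure_law hβ hβ2
  rw [rpow_risk_eq (by linarith) hβ hβ2 hf hT]
  refine setLIntegral_mono' measurableSet_Icc fun t ht => ?_
  obtain ⟨M, hM⟩ := hGb t ht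
  have hi : Integrable (G t) (law f) := Integrable.of_bound (hG t ht).aestronglyMeasurable M
    (Eventually.of_forall hM)
  have hi' : Integrable (fun X : Fin n → ℝ => kernelEstimator G n X t) (sampleLaw n f) :=
    (integrable_finsetSum _ fun k _ =>
      integrable_comp_eval (μ := fun _ : Fin n => law f) hi).const_mul _
  have hP : IsProbabilityMeasure (sampleLaw n f) := by unfold sampleLaw; infer_instance
  have hmean : ∫ X, (kernelEstimator G n X t - f t) ∂(sampleLaw n f) =
      (∫ x in Icc (0 : ℝ) 1, f x * G t x) - f t := by
    rw [integral_sub hi' (integrable_const _), ← hf.integral_law hβ hβ2]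
    simp only [integral_const, probReal_univ, one_smul]
    congr 1
    exact integral_average hn hi
  rw [← hmean]
  exact ofReal_abs_integral_rpow_le hp (hi'.sub (integrable_const _)).aestronglyMeasurable

lemma isHolderDensity_one {β L : ℝ} (hβ : 0 < β) (hβ2 : β ≤ 2) (hL : 0 ≤ L) :
    IsHolderDensity β L fun _ => 1 := by
  simpa using isHolderDensity_affine hβ hβ2 le_rfl zero_le_one hL

/-- The `p`-th power of the risk at the uniform density is at least that of the standard deviation
of the estimator, for kernels of integral one. -/
lemma lintegral_variance_le_rpow_risk {p β L : ℝ} {n : ℕ} {G : ℝ → ℝ → ℝ} (hp : 2 ≤ p)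
    (hβ : 0 < β) (hβ2 : β ≤ 2) (hL : 0 ≤ L) (hn : n ≠ 0)
    (hT : AEMeasurable (Function.uncurry (kernelEstimator G n))
      ((sampleLaw n fun _ => 1).prod (volume.restrict (Icc 0 1))))
    (hG : ∀ t ∈ Icc (0 : ℝ) 1, Measurable (G t))
    (hGb : ∀ t ∈ Icc (0 : ℝ) 1, ∃ M, ∀ x, |G t x| ≤ M)
    (hG1 : ∀ t ∈ Icc (0 : ℝ) 1, ∫ x in Icc (0 : ℝ) 1, G t x = 1) :
    ∫⁻ t in Icc (0 : ℝ) 1,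
        ENNReal.ofReal (1 / n * ((∫ x in Icc (0 : ℝ) 1, G t x ^ 2) - 1)) ^ (p / 2) ≤
      risk p n (kernelEstimator G n) (fun _ => 1) ^ p := by
  have hf : IsHolderDensity β L fun _ => 1 := isHolderDensity_one hβ hβ2 hL
  have := hf.isProbabilityMeasure_law hβ hβ2
  rw [rpow_risk_eq (by linarith) hβ hβ2 hf hT]
  refine setLIntegral_mono' measurableSet_Icc fun t ht => ?_
  obtain ⟨M, hM⟩ := hGb t ht
  have hlp : MemLp (G t) 2 (law fun _ => 1) := MemLp.of_bound (hG t ht).aestronglyMeasurable M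
    (Eventually.of_forall hM)
  have hP : IsProbabilityMeasure (sampleLaw n fun _ => 1) := by unfold sampleLaw; infer_instance
  have hm : ∫ x, G t x ∂(law fun _ => 1) = 1 := by
    rw [hf.integral_law hβ hβ2]; simpa using hG1 t ht
  have hvar := integral_average_sub_sq hn hlp
  rw [hm, hf.integral_law hβ hβ2] at hvar
  simp only [one_mul, one_pow] at hvar
  rw [← hvar]
  refine ofReal_integral_sq_rpow_le hp (Z := fun X => kernelEstimator G n X t - 1) ?_
  have hi' : Integrable (fun X : Fin n → ℝ => kernelEstimator G n X t) (sampleLaw n fun _ => 1) :=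
    (integrable_finsetSum _ fun k _ => integrable_comp_eval (μ := fun _ : Fin n => law fun _ => 1)
      (hlp.integrable one_le_two)).const_mul _
  exact (hi'.sub (integrable_const _)).aestronglyMeasurable

/-! ### Upper bound for the minimax risk -/

/-- The direction in which the one-sided kernel at `t` looks for observations, so that its window
remains in `[0, 1]`. -/
def side (t : ℝ) : ℝ := if t ≤ 1 / 2 then 1 else -1

lemma side_eq (t : ℝ) : side t = 1 ∨ side t = -1 := by
  unfold side; split_ifs <;> simp

lemma abs_side (t : ℝ) : |side t| = 1 := by
  rcases side_eq t with h | h <;> simp [h]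

lemma side_mul_self (t : ℝ) : side t * side t = 1 := by
  rcases side_eq t with h | h <;> simp [h]

lemma measurable_side : Measurable side :=
  Measurable.ite measurableSet_Iic measurable_const measurable_const

lemma add_side_mul_mem {t h u : ℝ} (ht : t ∈ Icc (0 : ℝ) 1) (hh : 0 < h) (hh2 : h ≤ 1 / 2)
    (hu : u ∈ Icc (0 : ℝ) 1) : t + side t * h * u ∈ Icc (0 : ℝ) 1 := by
  obtain ⟨ht0, ht1⟩ := ht
  obtain ⟨hu0, hu1⟩ := hu
  have h1 : 0 ≤ h * u := by positivity
  have h2 : h * u ≤ 1 / 2 := by nlinarith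
  unfold side
  split_ifs with h <;> constructor <;> linarith

/-- The kernel `h⁻¹ (4 - 6u)`, with `u = ±(x - t) / h` restricted to `[0, 1]`. As `4 - 6u` has
integral one and is orthogonal to `u` on `[0, 1]`, it reproduces affine functions exactly, up to
the boundary of `[0, 1]`. -/
def oneSidedKernel (h t x : ℝ) : ℝ :=
  h⁻¹ * (Icc (0 : ℝ) 1).indicator (fun u => 4 - 6 * u) (side t / h * (x - t))

lemma measurable_oneSidedKernel (h : ℝ) :
    Measurable fun z : ℝ × ℝ => oneSidedKernel h z.1 z.2 := by
  have h1 : Measurable ((Icc (0 : ℝ) 1).indicator fun u : ℝ => 4 - 6 * u) :=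
    Measurable.indicator (by fun_prop) measurableSet_Icc
  have h2 : Measurable fun z : ℝ × ℝ => side z.1 / h * (z.2 - z.1) :=
    ((measurable_side.comp measurable_fst).div_const h).mul (measurable_snd.sub measurable_fst)
  exact (h1.comp h2).const_mul _

lemma abs_oneSidedKernel_le {h : ℝ} (hh : 0 < h) (t x : ℝ) : |oneSidedKernel h t x| ≤ 4 / h := by
  rw [oneSidedKernel, abs_mul, abs_of_pos (inv_pos.mpr hh), div_eq_inv_mul 4 h]
  refine mul_le_mul_of_nonneg_left ?_ (inv_pos.mpr hh).le
  by_cases hu : side t / h * (x - t) ∈ Icc (0 : ℝ) 1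
  · rw [indicator_of_mem hu, abs_le]
    constructor <;> linarith [hu.1, hu.2]
  · rw [indicator_of_notMem hu, abs_zero]
    norm_num

/-- The substitution `x = t ± h u`. -/
lemma setIntegral_mul_indicator_side {t h : ℝ} (ht : t ∈ Icc (0 : ℝ) 1) (hh : 0 < h)
    (hh2 : h ≤ 1 / 2) (φ ψ : ℝ → ℝ) :
    ∫ x in Icc (0 : ℝ) 1, φ x * (Icc (0 : ℝ) 1).indicator ψ (side t / h * (x - t)) =
      h * ∫ u in Icc (0 : ℝ) 1, φ (t + side t * h * u) * ψ u := by
  have hs := side_mul_self t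
  have hinv : ∀ x, t + side t * h * (side t / h * (x - t)) = x := fun x => by
    calc t + side t * h * (side t / h * (x - t)) = t + side t * side t * (x - t) := by field_simp
      _ = x := by rw [hs]; ring
  rw [setIntegral_eq_integral_of_forall_compl_eq_zero]
  · have h1 : ∀ x, φ x * (Icc (0 : ℝ) 1).indicator ψ (side t / h * (x - t)) =
        (Icc (0 : ℝ) 1).indicator (fun u => φ (t + side t * h * u) * ψ u)
          (side t / h * (x - t)) := fun x => by
      by_cases hu : side t / h * (x - t) ∈ Icc (0 : ℝ) 1
      · rw [indicator_of_mem hu, indicator_of_mem hu, hinv]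
      · rw [indicator_of_notMem hu, indicator_of_notMem hu, mul_zero]
    simp_rw [h1]
    rw [integral_sub_right_eq_self (fun x => (Icc (0 : ℝ) 1).indicator
      (fun u => φ (t + side t * h * u) * ψ u) (side t / h * x)) t,
      Measure.integral_comp_mul_left, integral_indicator measurableSet_Icc, abs_inv, abs_div,
      abs_side, abs_of_pos hh, one_div, inv_inv, smul_eq_mul]
  · intro x hx
    rw [indicator_of_notMem, mul_zero]
    intro hu
    exact hx (by simpa [hinv] using add_side_mul_mem ht hh hh2 hu)

lemma setIntegral_mul_oneSidedKernel {t h : ℝ} (ht : t ∈ Icc (0 : ℝ) 1) (hh : 0 < h)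
    (hh2 : h ≤ 1 / 2) (f : ℝ → ℝ) :
    ∫ x in Icc (0 : ℝ) 1, f x * oneSidedKernel h t x =
      ∫ u in Icc (0 : ℝ) 1, f (t + side t * h * u) * (4 - 6 * u) := by
  have h1 : ∀ x, f x * oneSidedKernel h t x = h⁻¹ * (f x *
      (Icc (0 : ℝ) 1).indicator (fun u => 4 - 6 * u) (side t / h * (x - t))) := fun x => by
    rw [oneSidedKernel]; ring
  simp_rw [h1]
  rw [integral_const_mul, setIntegral_mul_indicator_side ht hh hh2, inv_mul_cancel_left₀ hh.ne']

lemma setIntegral_mul_oneSidedKernel_sq {t h : ℝ} (ht : t ∈ Icc (0 : ℝ) 1) (hh : 0 < h)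
    (hh2 : h ≤ 1 / 2) (f : ℝ → ℝ) :
    ∫ x in Icc (0 : ℝ) 1, f x * oneSidedKernel h t x ^ 2 =
      h⁻¹ * ∫ u in Icc (0 : ℝ) 1, f (t + side t * h * u) * (4 - 6 * u) ^ 2 := by
  have h1 : ∀ x, f x * oneSidedKernel h t x ^ 2 = h⁻¹ * h⁻¹ * (f x *
      (Icc (0 : ℝ) 1).indicator (fun u => (4 - 6 * u) ^ 2) (side t / h * (x - t))) := fun x => by
    rw [oneSidedKernel]
    by_cases hu : side t / h * (x - t) ∈ Icc (0 : ℝ) 1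
    · rw [indicator_of_mem hu, indicator_of_mem hu]; ring
    · rw [indicator_of_notMem hu, indicator_of_notMem hu]; ring
  simp_rw [h1]
  rw [integral_const_mul, setIntegral_mul_indicator_side ht hh hh2, mul_assoc,
    inv_mul_cancel_left₀ hh.ne']

lemma continuousOn_comp_side {t h : ℝ} {f : ℝ → ℝ} (ht : t ∈ Icc (0 : ℝ) 1) (hh : 0 < h)
    (hh2 : h ≤ 1 / 2) (hf : ContinuousOn f (Icc 0 1)) :
    ContinuousOn (fun u => f (t + side t * h * u)) (Icc 0 1) :=
  hf.comp (Continuous.continuousOn (by fun_prop)) fun _ hu => add_side_mul_mem ht hh hh2 hu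

lemma abs_bias_oneSidedKernel_le {β L t h : ℝ} {f : ℝ → ℝ} (hβ : 0 < β) (hβ2 : β ≤ 2) (hL : 0 < L)
    (hf : IsHolderDensity β L f) (ht : t ∈ Icc (0 : ℝ) 1) (hh : 0 < h) (hh2 : h ≤ 1 / 2) :
    |(∫ x in Icc (0 : ℝ) 1, f x * oneSidedKernel h t x) - f t| ≤ 4 * L * h ^ β := by
  obtain ⟨s, hs⟩ := hf.exists_slope hβ hβ2 ht
  have hc := continuousOn_comp_side ht hh hh2 (hf.continuousOn hβ hβ2)
  have hi : IntegrableOn (fun u => f (t + side t * h * u) * (4 - 6 * u)) (Icc (0 : ℝ) 1) :=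
    (hc.mul (Continuous.continuousOn (by fun_prop))).integrableOn_Icc
  have hi2 : IntegrableOn (fun u : ℝ => (f t + s * (side t * h) * u) * (4 - 6 * u))
    (Icc (0 : ℝ) 1) := (Continuous.continuousOn (by fun_prop)).integrableOn_Icc
  have hval : ∫ u in Icc (0 : ℝ) 1, (f t + s * (side t * h) * u) * (4 - 6 * u) = f t := by
    rw [integral_Icc_eq_integral_Ioc, ← intervalIntegral.integral_of_le zero_le_one,
      intervalIntegral.integral_eq_sub_of_hasDerivAt
        (f := fun u => f t * (4 * u - 3 * u ^ 2) + s * (side t * h) * (2 * u ^ 2 - 2 * u ^ 3))]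
    · norm_num
    · intro u _
      have h1 := (((hasDerivAt_id u).const_mul 4).fun_sub
        (((hasDerivAt_id u).pow 2).const_mul 3)).const_mul (f t)
      have h2 := ((((hasDerivAt_id u).pow 2).const_mul 2).fun_sub
        (((hasDerivAt_id u).pow 3).const_mul 2)).const_mul (s * (side t * h))
      convert! h1.fun_add h2 using 1
      simp; ring
    · exact Continuous.intervalIntegrable (by fun_prop) _ _
  rw [setIntegral_mul_oneSidedKernel ht hh hh2]
  nth_rewrite 1 [← hval]
  rw [← integral_sub hi hi2]
  have hb : ∀ u ∈ Icc (0 : ℝ) 1, ‖f (t + side t * h * u) * (4 - 6 * u) -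
      (f t + s * (side t * h) * u) * (4 - 6 * u)‖ ≤ 4 * L * h ^ β := fun u hu => by
    have h1 := hs _ (add_side_mul_mem ht hh hh2 hu)
    have h2 : |t + side t * h * u - t| ≤ h := by
      rw [add_sub_cancel_left, abs_mul, abs_mul, abs_side, one_mul, abs_of_pos hh,
        abs_of_nonneg hu.1]
      exact mul_le_of_le_one_right hh.le hu.2
    have h3 : |4 - 6 * u| ≤ 4 := by
      rw [abs_le]; constructor <;> linarith [hu.1, hu.2]
    have h4 : f (t + side t * h * u) * (4 - 6 * u) - (f t + s * (side t * h) * u) * (4 - 6 * u) =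
        (4 - 6 * u) * (f (t + side t * h * u) - f t - s * (t + side t * h * u - t)) := by ring
    rw [Real.norm_eq_abs, h4, abs_mul, mul_assoc 4 L]
    refine mul_le_mul h3 (h1.trans ?_) (abs_nonneg _) (by norm_num)
    gcongr
  have := norm_setIntegral_le_of_norm_le_const (μ := volume) (by simp) hb
  simpa using this

lemma IsHolderDensity.integral_oneSidedKernel_sq_le {β L t h : ℝ} {f : ℝ → ℝ} (hβ : 0 < β)
    (hβ2 : β ≤ 2) (hL : 0 < L) (hf : IsHolderDensity β L f) (ht : t ∈ Icc (0 : ℝ) 1) (hh : 0 < h)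
    (hh2 : h ≤ 1 / 2) :
    ∫ x, oneSidedKernel h t x ^ 2 ∂(law f) ≤ 16 * (2 + 4 * L) / h := by
  rw [hf.integral_law hβ hβ2, setIntegral_mul_oneSidedKernel_sq ht hh hh2, div_eq_inv_mul]
  refine mul_le_mul_of_nonneg_left ?_ (inv_pos.mpr hh).le
  have hc := continuousOn_comp_side ht hh hh2 (hf.continuousOn hβ hβ2)
  have hi : IntegrableOn (fun u => f (t + side t * h * u) * (4 - 6 * u) ^ 2) (Icc (0 : ℝ) 1) :=
    (hc.mul (Continuous.continuousOn (by fun_prop))).integrableOn_Icc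
  calc _ ≤ ∫ u in Icc (0 : ℝ) 1, 16 * (2 + 4 * L) := by
        refine setIntegral_mono_on hi (integrable_const _) measurableSet_Icc fun u hu => ?_
        have h1 := hf.le_bound hβ hβ2 hL (add_side_mul_mem ht hh hh2 hu)
        have h2 := hf.nonneg _ (add_side_mul_mem ht hh hh2 hu)
        have h3 : (4 - 6 * u) ^ 2 ≤ 16 := by nlinarith [hu.1, hu.2]
        rw [mul_comm]
        exact mul_le_mul h3 h1 h2 (by norm_num)
    _ = _ := by simp

/-- The rate `r` is balanced with the bandwidth `h`: the bias `h ^ β` and the standard deviation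
`(n h) ^ (-1 / 2)` are both equal to `r`. -/
lemma lintegral_oneSidedKernel_error_le {β L t h r p : ℝ} {n : ℕ} {f : ℝ → ℝ} (hp : 1 ≤ p)
    (hβ : 0 < β) (hβ2 : β ≤ 2) (hL : 0 < L) (hf : IsHolderDensity β L f)
    (ht : t ∈ Icc (0 : ℝ) 1) (hn : n ≠ 0) (hh : 0 < h) (hh2 : h ≤ 1 / 2) (hr : 0 < r)
    (hr1 : r ≤ 1) (hrh : h ^ β = r) (hrn : n * h * r ^ 2 = 1) :
    ∫⁻ X, ENNReal.ofReal |kernelEstimator (oneSidedKernel h) n X t - f t| ^ p ∂(sampleLaw n f) ≤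
      2 ^ (p - 1) * (ENNReal.ofReal (2 * Real.exp 1 * p ^ p * (8 * (2 + 4 * L) * r) ^ p) +
        ENNReal.ofReal (4 * L * r) ^ p) := by
  have hprob := hf.isProbabilityMeasure_law hβ hβ2
  have hP : IsProbabilityMeasure (sampleLaw n f) := by unfold sampleLaw; infer_instance
  have hn' : 0 < (n : ℝ) := by positivity
  set F : ℝ := 2 + 4 * L with hF
  have hF1 : 1 ≤ F := by linarith
  set G := oneSidedKernel h t with hG
  have hGm : Measurable G := (measurable_oneSidedKernel h).comp measurable_prodMk_left
  have hGb : ∀ x, |G x| ≤ 4 / h := abs_oneSidedKernel_le hh t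
  have hGlp : MemLp G 2 (law f) := MemLp.of_bound hGm.aestronglyMeasurable (4 / h)
    (Eventually.of_forall hGb)
  have hGi : Integrable G (law f) := hGlp.integrable one_le_two
  set m := ∫ x, G x ∂(law f) with hm
  have hmb : |m| ≤ 4 / h := by
    have := norm_integral_le_of_norm_le_const (μ := law f) (f := G) (Eventually.of_forall hGb)
    simpa using this
  have hbias : |m - f t| ≤ 4 * L * r := by
    rw [hm, hf.integral_law hβ hβ2, ← hrh]
    exact abs_bias_oneSidedKernel_le hβ hβ2 hL hf ht hh hh2
  have hU2 : ∫ x, (G x - m) ^ 2 ∂(law f) ≤ 16 * F / h := by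
    have h1 := ProbabilityTheory.variance_le_expectation_sq (μ := law f) (X := G)
      hGm.aestronglyMeasurable
    rw [ProbabilityTheory.variance_eq_integral hGm.aemeasurable] at h1
    exact h1.trans (hf.integral_oneSidedKernel_sq_le hβ hβ2 hL ht hh hh2)
  have hU0 : ∫ x, (G x - m) ∂(law f) = 0 := by
    rw [integral_sub hGi (integrable_const _)]
    simp [hm]
  have hUb : ∀ x, |G x - m| ≤ 8 / h := fun x => by
    refine (abs_sub _ _).trans ((add_le_add (hGb x) hmb).trans_eq ?_)
    ring
  -- For this `l`, of order `(n v) ^ (-1 / 2)`, both side conditions reduce to `n h r ^ 2 = 1`.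
  have hmom := lintegral_abs_sum_rpow_le (n := n) (l := (8 * F * (n * r))⁻¹) (p := p)
    (by linarith) (hGm.sub_const m) hUb hU0 hU2 (by positivity) (by
      rw [inv_mul_le_one₀ (by positivity), div_le_iff₀ hh]
      have h2 : 1 ≤ n * h * r := by nlinarith [mul_pos hn' hh]
      nlinarith) (by
      have h2 : (n : ℝ) * (((8 * F * (n * r))⁻¹) ^ 2 * (16 * F / h)) =
        (n * h * r ^ 2)⁻¹ * (4 * F)⁻¹ := by field_simp; norm_num
      rw [h2, hrn, inv_one, one_mul]
      exact inv_le_one_of_one_le₀ (by linarith))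
  rw [inv_inv] at hmom
  have hpt : ∀ X : Fin n → ℝ, ENNReal.ofReal |kernelEstimator (oneSidedKernel h) n X t - f t| ^ p ≤
      2 ^ (p - 1) * (ENNReal.ofReal (1 / n) ^ p * ENNReal.ofReal |∑ k, (G (X k) - m)| ^ p +
        ENNReal.ofReal (4 * L * r) ^ p) := fun X => by
    have h1 : kernelEstimator (oneSidedKernel h) n X t - f t =
        1 / n * ∑ k, (G (X k) - m) + (m - f t) := by
      rw [kernelEstimator, Finset.sum_sub_distrib, mul_sub]
      simp only [Finset.sum_const, Finset.card_univ, Fintype.card_fin, nsmul_eq_mul]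
      field_simp
      ring
    have h2 : |kernelEstimator (oneSidedKernel h) n X t - f t| ≤
        1 / n * |∑ k, (G (X k) - m)| + 4 * L * r := by
      rw [h1]
      refine (abs_add_le _ _).trans (add_le_add (le_of_eq ?_) hbias)
      rw [abs_mul, abs_of_pos (by positivity : 0 < 1 / (n : ℝ))]
    calc _ ≤ (ENNReal.ofReal (1 / n) * ENNReal.ofReal |∑ k, (G (X k) - m)| +
          ENNReal.ofReal (4 * L * r)) ^ p := by
          refine ENNReal.rpow_le_rpow ?_ (by linarith)
          rw [← ENNReal.ofReal_mul (by positivity),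
            ← ENNReal.ofReal_add (by positivity) (by positivity)]
          exact ENNReal.ofReal_le_ofReal h2
      _ ≤ 2 ^ (p - 1) * ((ENNReal.ofReal (1 / n) * ENNReal.ofReal |∑ k, (G (X k) - m)|) ^ p +
          ENNReal.ofReal (4 * L * r) ^ p) := ENNReal.rpow_add_le_mul_rpow_add_rpow _ _ hp
      _ = _ := by rw [ENNReal.mul_rpow_of_nonneg _ _ (by linarith)]
  have hSm : Measurable fun X : Fin n → ℝ => ENNReal.ofReal |∑ k, (G (X k) - m)| ^ p :=
    ((measurable_norm.comp (Finset.measurable_sum _ fun k _ =>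
      (hGm.comp (measurable_pi_apply k)).sub_const m)).ennreal_ofReal).pow_const p
  refine (lintegral_mono hpt).trans ?_
  rw [lintegral_const_mul _ ((hSm.const_mul _).fun_add measurable_const),
    lintegral_add_left (hSm.const_mul _), lintegral_const_mul _ hSm, lintegral_const,
    measure_univ, mul_one]
  gcongr
  refine (mul_le_mul_right hmom _).trans ?_
  rw [ENNReal.ofReal_rpow_of_nonneg (by positivity) (by linarith),
    ← ENNReal.ofReal_mul (by positivity)]
  refine ENNReal.ofReal_le_ofReal (le_of_eq ?_)
  have h3 : (8 * F * (n * r)) ^ p = n ^ p * (8 * F * r) ^ p := by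
    rw [← Real.mul_rpow (by positivity) (by positivity)]; ring_nf
  rw [h3, one_div, Real.inv_rpow hn'.le]
  field_simp

lemma measurable_kernelEstimator {G : ℝ → ℝ → ℝ} (hG : Measurable fun z : ℝ × ℝ => G z.1 z.2)
    (n : ℕ) : Measurable (Function.uncurry (kernelEstimator G n)) := by
  have : Function.uncurry (kernelEstimator G n) =
      fun z : (Fin n → ℝ) × ℝ => 1 / (n : ℝ) * ∑ k, G z.2 (z.1 k) := by
    ext z; rfl
  rw [this]
  refine (Finset.measurable_sum _ fun k _ => ?_).const_mul _
  exact hG.comp (measurable_snd.prodMk ((measurable_pi_apply k).comp measurable_fst))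

/-- The minimax rate of convergence is at least as fast as `n ^ (-β / (2 β + 1))`. -/
theorem exists_minimaxRisk_le {p β L : ℝ} (hp : 1 ≤ p) (hβ : 0 < β) (hβ2 : β ≤ 2) (hL : 0 < L) :
    ∃ C : ℝ, 0 < C ∧ ∀ᶠ n : ℕ in atTop,
      minimaxRisk p n β L ≤ ENNReal.ofReal (C * (n : ℝ) ^ (-(β / (2 * β + 1)))) := by
  have hp0 : 0 < p := by linarith
  set A : ℝ := 2 ^ (p - 1) * (2 * Real.exp 1 * p ^ p * (8 * (2 + 4 * L)) ^ p + (4 * L) ^ p)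
    with hA
  have hA0 : 0 < A := by positivity
  refine ⟨A ^ (1 / p), by positivity, ?_⟩
  have hlim : Tendsto (fun n : ℕ => (n : ℝ) ^ (-(1 / (2 * β + 1)))) atTop (nhds 0) :=
    (tendsto_rpow_neg_atTop (by positivity)).comp tendsto_natCast_atTop_atTop
  filter_upwards [hlim.eventually (ge_mem_nhds (by norm_num : (0 : ℝ) < 1 / 2)),
    eventually_ge_atTop 1] with n hnh hn1
  have hn : 1 ≤ (n : ℝ) := by exact_mod_cast hn1
  have hn0 : 0 < (n : ℝ) := by linarith
  set h : ℝ := (n : ℝ) ^ (-(1 / (2 * β + 1))) with hh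
  set r : ℝ := (n : ℝ) ^ (-(β / (2 * β + 1))) with hr
  have hh0 : 0 < h := by positivity
  have hr0 : 0 < r := by positivity
  have hr1 : r ≤ 1 := Real.rpow_le_one_of_one_le_of_nonpos hn (by
    rw [neg_nonpos]; positivity)
  have hrh : h ^ β = r := by
    rw [hh, hr, ← Real.rpow_mul hn0.le]; congr 1; field_simp
  have hrn : n * h * r ^ 2 = 1 := by
    have e1 : (n : ℝ) * h * r ^ 2 =
        (n : ℝ) ^ (1 + -(1 / (2 * β + 1)) + -(β / (2 * β + 1)) * 2) := by
      rw [Real.rpow_add hn0, Real.rpow_add hn0, Real.rpow_one, Real.rpow_mul hn0.le,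
        Real.rpow_two]
    have e2 : 1 + -(1 / (2 * β + 1)) + -(β / (2 * β + 1)) * 2 = 0 := by field_simp; ring
    rw [e1, e2, Real.rpow_zero]
  have hmeas := measurable_kernelEstimator (measurable_oneSidedKernel h) n
  refine (iInf₂_le (kernelEstimator (oneSidedKernel h) n) hmeas).trans (iSup₂_le fun f hf => ?_)
  have hle : risk p n (kernelEstimator (oneSidedKernel h) n) f ^ p ≤ ENNReal.ofReal (A * r ^ p) := by
    rw [rpow_risk_eq hp0 hβ hβ2 hf hmeas.aemeasurable]
    calc _ ≤ ∫⁻ t in Icc (0 : ℝ) 1, ENNReal.ofReal (A * r ^ p) := by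
          refine setLIntegral_mono' measurableSet_Icc fun t ht => ?_
          refine (lintegral_oneSidedKernel_error_le hp hβ hβ2 hL hf ht (by omega) hh0 hnh hr0 hr1
            hrh hrn).trans_eq ?_
          rw [ENNReal.ofReal_rpow_of_nonneg (by positivity) hp0.le,
            ← ENNReal.ofReal_add (by positivity) (by positivity),
            ← ENNReal.ofReal_ofNat 2, ENNReal.ofReal_rpow_of_pos two_pos,
            ← ENNReal.ofReal_mul (by positivity), Real.mul_rpow (by positivity) hr0.le,
            Real.mul_rpow (by positivity) hr0.le]
          congr 1
          rw [hA]
          ring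
      _ = _ := by simp
  have h1 := ENNReal.rpow_le_rpow hle (by positivity : 0 ≤ 1 / p)
  rw [← ENNReal.rpow_mul, mul_one_div_cancel hp0.ne', ENNReal.rpow_one,
    ENNReal.ofReal_rpow_of_nonneg (by positivity) (by positivity),
    Real.mul_rpow hA0.le (by positivity), ← Real.rpow_mul hr0.le, mul_one_div_cancel hp0.ne',
    Real.rpow_one] at h1
  exact h1

/-! ### Moments and measurability of the beta kernel -/

lemma beta_add_one {α γ : ℝ} (hα : 0 < α) (hγ : 0 < γ) :
    ProbabilityTheory.beta (α + 1) γ = α / (α + γ) * ProbabilityTheory.beta α γ := by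
  have h1 : Real.Gamma (α + γ) ≠ 0 := (Real.Gamma_pos_of_pos (by positivity)).ne'
  rw [ProbabilityTheory.beta, ProbabilityTheory.beta, Real.Gamma_add_one hα.ne',
    show α + 1 + γ = (α + γ) + 1 by ring, Real.Gamma_add_one (by positivity)]
  field_simp

lemma continuous_rpow_mul_rpow {α γ : ℝ} (hα : 0 ≤ α) (hγ : 0 ≤ γ) :
    Continuous fun x : ℝ => x ^ α * (1 - x) ^ γ :=
  (continuous_id.rpow_const fun _ => Or.inr hα).mul
    ((continuous_const.sub continuous_id).rpow_const fun _ => Or.inr hγ)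

lemma setIntegral_rpow_mul_rpow {α γ : ℝ} (hα : 0 ≤ α) (hγ : 0 ≤ γ) :
    ∫ x in Icc (0 : ℝ) 1, x ^ α * (1 - x) ^ γ = ProbabilityTheory.beta (α + 1) (γ + 1) := by
  have hc := continuous_rpow_mul_rpow hα hγ
  rw [ProbabilityTheory.beta_eq_betaIntegralReal _ _ (by positivity) (by positivity),
    Complex.betaIntegral, integral_Icc_eq_integral_Ioc,
    ← intervalIntegral.integral_of_le zero_le_one, ← Complex.ofReal_re
      (∫ x in (0 : ℝ)..1, x ^ α * (1 - x) ^ γ), ← intervalIntegral.integral_ofReal]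
  congr 1
  refine intervalIntegral.integral_congr fun x hx => ?_
  rw [uIcc_of_le zero_le_one] at hx
  simp only [Complex.ofReal_mul, Complex.ofReal_add, Complex.ofReal_one, add_sub_cancel_right]
  rw [Complex.ofReal_cpow hx.1, Complex.ofReal_cpow (by linarith [hx.2])]
  push_cast
  rfl

section Kernel

variable {t b : ℝ}

lemma kernel_nonneg (hb : 0 < b) (ht : t ∈ Icc (0 : ℝ) 1) (x : ℝ) : 0 ≤ kernel t b x := by
  obtain ⟨ht0, ht1⟩ := ht
  have h1 : 0 ≤ 1 - t := by linarith
  rw [kernel]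
  refine indicator_apply_nonneg fun hx => ?_
  have h2 : 0 ≤ 1 - x := by linarith [hx.2]
  have h3 : 0 ≤ x := hx.1
  have := (ProbabilityTheory.beta_pos (by positivity : 0 < t / b + 1)
    (by positivity : 0 < (1 - t) / b + 1)).le
  positivity

lemma abs_kernel_le (hb : 0 < b) (ht : t ∈ Icc (0 : ℝ) 1) (x : ℝ) :
    |kernel t b x| ≤ (ProbabilityTheory.beta (t / b + 1) ((1 - t) / b + 1))⁻¹ := by
  obtain ⟨ht0, ht1⟩ := ht
  have h1 : 0 ≤ 1 - t := by linarith
  have hB := (ProbabilityTheory.beta_pos (by positivity : 0 < t / b + 1)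
    (by positivity : 0 < (1 - t) / b + 1))
  rw [abs_of_nonneg (kernel_nonneg hb ⟨ht0, ht1⟩ x)]
  rw [kernel]
  refine indicator_apply_le' (fun hx => ?_) (fun _ => ?_)
  · have h2 : 0 ≤ 1 - x := by linarith [hx.2]
    rw [div_eq_mul_inv]
    refine mul_le_of_le_one_left (inv_pos.mpr hB).le (mul_le_one₀ ?_ (by positivity) ?_)
    · exact Real.rpow_le_one hx.1 hx.2 (by positivity)
    · exact Real.rpow_le_one h2 (by linarith [hx.1]) (by positivity)
  · exact (inv_pos.mpr hB).le

lemma measurable_kernel (t b : ℝ) : Measurable (kernel t b) :=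
  Measurable.indicator (by fun_prop) measurableSet_Icc

lemma integrableOn_mul_kernel (hb : 0 < b) (ht : t ∈ Icc (0 : ℝ) 1) {g : ℝ → ℝ}
    (hg : Continuous g) : IntegrableOn (fun x => g x * kernel t b x) (Icc 0 1) := by
  refine Integrable.mul_bdd (c := (ProbabilityTheory.beta (t / b + 1) ((1 - t) / b + 1))⁻¹)
    hg.integrableOn_Icc (measurable_kernel t b).aestronglyMeasurable ?_
  exact Eventually.of_forall fun x => abs_kernel_le hb ht x

lemma setIntegral_pow_mul_kernel (hb : 0 < b) (ht : t ∈ Icc (0 : ℝ) 1) (j : ℕ) :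
    ∫ x in Icc (0 : ℝ) 1, x ^ j * kernel t b x =
      ProbabilityTheory.beta (t / b + j + 1) ((1 - t) / b + 1) /
        ProbabilityTheory.beta (t / b + 1) ((1 - t) / b + 1) := by
  obtain ⟨ht0, ht1⟩ := ht
  have h1 : 0 ≤ 1 - t := by linarith
  rw [← setIntegral_rpow_mul_rpow (by positivity) (by positivity), ← integral_div]
  refine setIntegral_congr_fun measurableSet_Icc fun x hx => ?_
  simp only [kernel, indicator_of_mem hx]
  rw [Real.rpow_add_of_nonneg hx.1 (by positivity) (by positivity), Real.rpow_natCast]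
  ring

lemma setIntegral_kernel (hb : 0 < b) (ht : t ∈ Icc (0 : ℝ) 1) :
    ∫ x in Icc (0 : ℝ) 1, kernel t b x = 1 := by
  have := setIntegral_pow_mul_kernel hb ht 0
  obtain ⟨ht0, ht1⟩ := ht
  have h1 : 0 ≤ 1 - t := by linarith
  have hB := (ProbabilityTheory.beta_pos (by positivity : 0 < t / b + 1)
    (by positivity : 0 < (1 - t) / b + 1))
  simpa [hB.ne'] using this

lemma setIntegral_pow_succ_mul_kernel (hb : 0 < b) (ht : t ∈ Icc (0 : ℝ) 1) (j : ℕ) :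
    ∫ x in Icc (0 : ℝ) 1, x ^ (j + 1) * kernel t b x =
      (t + (j + 1) * b) / (1 + (j + 2) * b) * ∫ x in Icc (0 : ℝ) 1, x ^ j * kernel t b x := by
  rw [setIntegral_pow_mul_kernel hb ht, setIntegral_pow_mul_kernel hb ht]
  obtain ⟨ht0, ht1⟩ := ht
  have h1 : 0 ≤ 1 - t := by linarith
  have h2 : t / b + ((j + 1 : ℕ) : ℝ) + 1 = (t / b + j + 1) + 1 := by push_cast; ring
  rw [h2, beta_add_one (by positivity) (by positivity), mul_div_assoc]
  congr 1
  have h3 : t / b + j + 1 = (t + (j + 1) * b) / b := by field_simp; ring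
  have h4 : t / b + j + 1 + ((1 - t) / b + 1) = (1 + (j + 2) * b) / b := by field_simp; ring
  rw [h4, h3]
  field_simp

lemma kernel_moments (hb : 0 < b) (ht : t ∈ Icc (0 : ℝ) 1) :
    ∫ x in Icc (0 : ℝ) 1, x * kernel t b x = (t + b) / (1 + 2 * b) ∧
    ∫ x in Icc (0 : ℝ) 1, x ^ 2 * kernel t b x =
      (t + 2 * b) / (1 + 3 * b) * ((t + b) / (1 + 2 * b)) ∧
    ∫ x in Icc (0 : ℝ) 1, x ^ 3 * kernel t b x =
      (t + 3 * b) / (1 + 4 * b) * ((t + 2 * b) / (1 + 3 * b) * ((t + b) / (1 + 2 * b))) ∧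
    ∫ x in Icc (0 : ℝ) 1, x ^ 4 * kernel t b x =
      (t + 4 * b) / (1 + 5 * b) * ((t + 3 * b) / (1 + 4 * b) *
        ((t + 2 * b) / (1 + 3 * b) * ((t + b) / (1 + 2 * b)))) := by
  have e1 : ∫ x in Icc (0 : ℝ) 1, x ^ 1 * kernel t b x = (t + b) / (1 + 2 * b) := by
    have := setIntegral_pow_succ_mul_kernel hb ht 0
    simpa [setIntegral_kernel hb ht] using this
  have e2 := setIntegral_pow_succ_mul_kernel hb ht 1
  have e3 := setIntegral_pow_succ_mul_kernel hb ht 2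
  have e4 := setIntegral_pow_succ_mul_kernel hb ht 3
  norm_num at e2 e3 e4
  simp only [pow_one] at e1
  rw [e1] at e2
  rw [e2] at e3
  rw [e3] at e4
  exact ⟨e1, e2, e3, e4⟩

lemma setIntegral_sub_sq_mul_kernel (hb : 0 < b) (ht : t ∈ Icc (0 : ℝ) 1) :
    ∫ x in Icc (0 : ℝ) 1, (x - t) ^ 2 * kernel t b x =
      b * (t * (1 - t) + b * (2 - 6 * (t * (1 - t)))) / ((1 + 2 * b) * (1 + 3 * b)) := by
  obtain ⟨e1, e2, -, -⟩ := kernel_moments hb ht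
  have h0 : IntegrableOn (fun x => kernel t b x) (Icc 0 1) := by
    simpa using integrableOn_mul_kernel hb ht (g := fun _ => 1) continuous_const
  have h1 := integrableOn_mul_kernel hb ht (g := fun x => x) (by fun_prop)
  have h2 := integrableOn_mul_kernel hb ht (g := fun x => x ^ 2) (by fun_prop)
  have hx : ∀ x, (x - t) ^ 2 * kernel t b x =
      x ^ 2 * kernel t b x - 2 * t * (x * kernel t b x) + t ^ 2 * kernel t b x := fun x => by ring
  simp_rw [hx]
  rw [integral_add (h2.fun_sub (h1.const_mul _)) (h0.const_mul _),
    integral_sub h2 (h1.const_mul _), integral_const_mul, integral_const_mul, e1, e2,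
    setIntegral_kernel hb ht]
  field_simp
  ring

lemma setIntegral_sub_pow_four_mul_kernel (hb : 0 < b) (ht : t ∈ Icc (0 : ℝ) 1) :
    ∫ x in Icc (0 : ℝ) 1, (x - t) ^ 4 * kernel t b x =
      b ^ 2 * (3 * (t * (1 - t)) ^ 2 + b * (26 * (t * (1 - t)) - 86 * (t * (1 - t)) ^ 2) +
        b ^ 2 * (24 - 120 * (t * (1 - t)) + 120 * (t * (1 - t)) ^ 2)) /
        ((1 + 2 * b) * (1 + 3 * b) * (1 + 4 * b) * (1 + 5 * b)) := by
  obtain ⟨e1, e2, e3, e4⟩ := kernel_moments hb ht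
  have h0 : IntegrableOn (fun x => kernel t b x) (Icc 0 1) := by
    simpa using integrableOn_mul_kernel hb ht (g := fun _ => 1) continuous_const
  have h1 := integrableOn_mul_kernel hb ht (g := fun x => x) (by fun_prop)
  have h2 := integrableOn_mul_kernel hb ht (g := fun x => x ^ 2) (by fun_prop)
  have h3 := integrableOn_mul_kernel hb ht (g := fun x => x ^ 3) (by fun_prop)
  have h4 := integrableOn_mul_kernel hb ht (g := fun x => x ^ 4) (by fun_prop)
  have hx : ∀ x, (x - t) ^ 4 * kernel t b x =
      x ^ 4 * kernel t b x - 4 * t * (x ^ 3 * kernel t b x) + 6 * t ^ 2 * (x ^ 2 * kernel t b x) -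
        4 * t ^ 3 * (x * kernel t b x) + t ^ 4 * kernel t b x := fun x => by ring
  simp_rw [hx]
  rw [integral_add (((h4.fun_sub (h3.const_mul _)).fun_add (h2.const_mul _)).fun_sub
      (h1.const_mul _)) (h0.const_mul _),
    integral_sub ((h4.fun_sub (h3.const_mul _)).fun_add (h2.const_mul _)) (h1.const_mul _),
    integral_add (h4.fun_sub (h3.const_mul _)) (h2.const_mul _),
    integral_sub h4 (h3.const_mul _), integral_const_mul, integral_const_mul, integral_const_mul,
    integral_const_mul, e1, e2, e3, e4, setIntegral_kernel hb ht]
  field_simp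
  ring

lemma le_setIntegral_sub_sq_mul_kernel (hb : 0 < b) (hb1 : b ≤ 1)
    (ht : t ∈ Icc (1 / 4 : ℝ) (3 / 4)) :
    b / 64 ≤ ∫ x in Icc (0 : ℝ) 1, (x - t) ^ 2 * kernel t b x := by
  obtain ⟨ht0, ht1⟩ := ht
  rw [setIntegral_sub_sq_mul_kernel hb ⟨by linarith, by linarith⟩, le_div_iff₀ (by positivity)]
  have hq : 3 / 16 ≤ t * (1 - t) := by nlinarith
  have hq' : t * (1 - t) ≤ 1 / 4 := by nlinarith [sq_nonneg (t - 1 / 2)]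
  have h1 : (1 + 2 * b) * (1 + 3 * b) ≤ 12 := by nlinarith
  have h2 : 3 / 16 ≤ t * (1 - t) + b * (2 - 6 * (t * (1 - t))) := by nlinarith
  calc b / 64 * ((1 + 2 * b) * (1 + 3 * b)) ≤ b / 64 * 12 := by gcongr
    _ = b * (3 / 16) := by ring
    _ ≤ _ := by gcongr

lemma setIntegral_sub_sq_mul_kernel_le (hb : 0 < b) (hbt : b ≤ t) (ht1 : t ≤ 1) :
    ∫ x in Icc (0 : ℝ) 1, (x - t) ^ 2 * kernel t b x ≤ 3 * (b * t) := by
  have ht0 : 0 < t := hb.trans_le hbt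
  rw [setIntegral_sub_sq_mul_kernel hb ⟨ht0.le, ht1⟩]
  have hq : 0 ≤ t * (1 - t) := mul_nonneg ht0.le (by linarith)
  have h2 : t * (1 - t) + b * (2 - 6 * (t * (1 - t))) ≤ 3 * t := by nlinarith
  have h1 : 1 ≤ (1 + 2 * b) * (1 + 3 * b) := by nlinarith
  rw [div_le_iff₀ (by positivity)]
  calc _ ≤ b * (3 * t) := by gcongr
    _ = 3 * (b * t) * 1 := by ring
    _ ≤ _ := by gcongr

lemma setIntegral_sub_pow_four_mul_kernel_le (hb : 0 < b) (hb1 : b ≤ 1)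
    (ht : t ∈ Icc (0 : ℝ) 1) :
    ∫ x in Icc (0 : ℝ) 1, (x - t) ^ 4 * kernel t b x ≤ 32 * b ^ 2 := by
  rw [setIntegral_sub_pow_four_mul_kernel hb ht]
  obtain ⟨ht0, ht1⟩ := ht
  set q := t * (1 - t) with hq
  have hq0 : 0 ≤ q := mul_nonneg ht0 (by linarith)
  have hq' : q ≤ 1 / 4 := by nlinarith [sq_nonneg (t - 1 / 2)]
  have hq2 : q ^ 2 ≤ q / 4 := by nlinarith
  have h1 : 1 ≤ (1 + 2 * b) * (1 + 3 * b) * (1 + 4 * b) * (1 + 5 * b) := by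
    have e : ∀ c : ℝ, 0 ≤ c → 1 ≤ 1 + c * b := fun c hc => by nlinarith
    exact one_le_mul_of_one_le_of_one_le (one_le_mul_of_one_le_of_one_le
      (one_le_mul_of_one_le_of_one_le (e 2 (by norm_num)) (e 3 (by norm_num)))
      (e 4 (by norm_num))) (e 5 (by norm_num))
  have hA : b * (26 * q - 86 * q ^ 2) ≤ 7 := by
    have : 26 * q - 86 * q ^ 2 ≤ 7 := by nlinarith
    nlinarith
  have hB : b ^ 2 * (24 - 120 * q + 120 * q ^ 2) ≤ 24 := by
    have h3 : 24 - 120 * q + 120 * q ^ 2 ≤ 24 := by nlinarith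
    have h4 : b ^ 2 ≤ 1 := by nlinarith
    nlinarith [sq_nonneg b]
  rw [div_le_iff₀ (by positivity)]
  calc _ ≤ b ^ 2 * 32 := by gcongr; nlinarith
    _ = 32 * b ^ 2 * 1 := by ring
    _ ≤ _ := by gcongr

end Kernel

lemma aemeasurable_beta {b : ℝ} (hb : 0 < b) :
    AEMeasurable (fun t => ProbabilityTheory.beta (t / b + 1) ((1 - t) / b + 1))
      (volume.restrict (Icc 0 1)) := by
  refine ContinuousOn.aemeasurable ?_ measurableSet_Icc
  have hG : ContinuousOn Real.Gamma (Ioi 0) := Real.differentiableOn_Gamma_Ioi.continuousOn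
  have h1 : ContinuousOn (fun t => Real.Gamma (t / b + 1)) (Icc 0 1) :=
    hG.comp (Continuous.continuousOn (by fun_prop)) fun t ht => by
      have := ht.1
      simp only [mem_Ioi]; positivity
  have h2 : ContinuousOn (fun t => Real.Gamma ((1 - t) / b + 1)) (Icc 0 1) :=
    hG.comp (Continuous.continuousOn (by fun_prop)) fun t ht => by
      have : 0 ≤ 1 - t := by linarith [ht.2]
      simp only [mem_Ioi]; positivity
  have h3 : (fun t => Real.Gamma (t / b + 1 + ((1 - t) / b + 1))) =
      fun _ => Real.Gamma (1 / b + 2) := by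
    funext t; congr 1; field_simp; ring
  refine (h1.mul h2).div (by rw [h3]; exact continuousOn_const) fun t _ => ?_
  rw [congrFun h3 t]
  exact (Real.Gamma_pos_of_pos (by positivity)).ne'

lemma aemeasurable_kernel_comp {Ω : Type*} [MeasurableSpace Ω] {P : Measure Ω} [SFinite P]
    {b : ℝ} (hb : 0 < b) {φ : Ω → ℝ} (hφ : Measurable φ) :
    AEMeasurable (fun z : Ω × ℝ => kernel z.2 b (φ z.1))
      (P.prod (volume.restrict (Icc 0 1))) := by
  have h1 : Measurable fun z : ℝ × ℝ => ({z : ℝ × ℝ | z.1 ∈ Icc (0 : ℝ) 1}.indicator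
      (fun z : ℝ × ℝ => z.1 ^ (z.2 / b) * (1 - z.1) ^ ((1 - z.2) / b))) z :=
    Measurable.indicator (by fun_prop) (measurable_fst measurableSet_Icc)
  have h2 := (h1.comp ((hφ.comp measurable_fst).prodMk
    (measurable_snd : Measurable (Prod.snd : Ω × ℝ → ℝ)))).aemeasurable.div
    ((aemeasurable_beta hb).comp_snd (μ := P))
  refine h2.congr (Eventually.of_forall fun z => ?_)
  by_cases hz : φ z.1 ∈ Icc (0 : ℝ) 1
  · obtain ⟨h0, h1⟩ := hz
    simp [kernel, indicator, h0, h1]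
  · have hz' : ¬ (0 ≤ φ z.1 ∧ φ z.1 ≤ 1) := hz
    simp only [kernel, indicator, Pi.div_apply, Function.comp_apply, mem_ofPred_eq, mem_Icc, hz',
      if_false, zero_div]

lemma aemeasurable_estimator {b : ℝ} (hb : 0 < b) (n : ℕ) (P : Measure (Fin n → ℝ)) [SFinite P] :
    AEMeasurable (Function.uncurry (kernelEstimator (fun t x => kernel t b x) n))
      (P.prod (volume.restrict (Icc 0 1))) := by
  have : Function.uncurry (kernelEstimator (fun t x => kernel t b x) n) =
      fun z : (Fin n → ℝ) × ℝ => 1 / (n : ℝ) * ∑ k, kernel z.2 b (z.1 k) := by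
    ext z; rfl
  rw [this]
  exact (Finset.aemeasurable_fun_sum _ fun k _ =>
    aemeasurable_kernel_comp hb (measurable_pi_apply k)).const_mul _

lemma aemeasurable_setIntegral_mul_kernel {b : ℝ} (hb : 0 < b) {f : ℝ → ℝ} (hf : Measurable f) :
    AEMeasurable (fun t => ∫ x in Icc (0 : ℝ) 1, f x * kernel t b x)
      (volume.restrict (Icc 0 1)) := by
  have h1 : AEMeasurable (fun z : ℝ × ℝ => f z.1 * kernel z.2 b z.1)
      ((volume.restrict (Icc 0 1)).prod (volume.restrict (Icc 0 1))) :=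
    (hf.comp measurable_fst).aemeasurable.mul (aemeasurable_kernel_comp hb measurable_id)
  exact h1.aestronglyMeasurable.prod_swap.integral_prod_right'.aemeasurable

/-! ### Lower bounds for the beta kernel estimator -/

lemma risk_le_maxRisk {p β L : ℝ} {n : ℕ} {T : (Fin n → ℝ) → ℝ → ℝ} {f : ℝ → ℝ}
    (hf : IsHolderDensity β L f) : risk p n T f ≤ maxRisk p n T β L :=
  le_iSup₂ (f := fun (f : ℝ → ℝ) (_ : IsHolderDensity β L f) => risk p n T f) f hf

/-- The variance of `K_{t,b}` under the uniform law is of order at least `(b t) ^ (-1 / 2)`,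
because the kernel has mass at least `3 / 4` on an interval of length of order
`(b t) ^ (1 / 2)`. -/
lemma le_setIntegral_kernel_sq_sub_one {b t : ℝ} (hb : 0 < b) (hb1 : b ≤ 1 / 1000) (hbt : b ≤ t)
    (ht1 : t ≤ 1) :
    1 / (32 * Real.sqrt (b * t)) ≤ (∫ x in Icc (0 : ℝ) 1, kernel t b x ^ 2) - 1 := by
  have ht0 : 0 < t := hb.trans_le hbt
  have ht : t ∈ Icc (0 : ℝ) 1 := ⟨ht0.le, ht1⟩
  have hbt0 : 0 < b * t := by positivity
  set s := Real.sqrt (b * t) with hs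
  have hs0 : 0 < s := Real.sqrt_pos.mpr hbt0
  have hs2 : s ^ 2 = b * t := Real.sq_sqrt hbt0.le
  have hs1 : s ≤ 1 / 25 := by
    refine abs_le_of_sq_le_sq' ?_ (by norm_num) |>.2
    rw [hs2]; nlinarith
  set δ := 7 / 2 * s with hδ
  have hδ0 : 0 < δ := by positivity
  -- Optimal constant in `K ^ 2 ≥ 2 c K - c ^ 2` on the window `|x - t| ≤ δ`.
  set c := 3 / (8 * δ) with hc
  have hc0 : 0 < c := by positivity
  have h0 : IntegrableOn (fun x => kernel t b x) (Icc 0 1) := by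
    simpa using integrableOn_mul_kernel hb ht (g := fun _ => 1) continuous_const
  have h2 := integrableOn_mul_kernel hb ht (g := fun x => (x - t) ^ 2) (by fun_prop)
  have hK2 : IntegrableOn (fun x => kernel t b x ^ 2) (Icc 0 1) := by
    refine Integrable.of_bound ((measurable_kernel t b).pow_const 2).aestronglyMeasurable
      ((ProbabilityTheory.beta (t / b + 1) ((1 - t) / b + 1))⁻¹ ^ 2)
      (Eventually.of_forall fun x => ?_)
    rw [Real.norm_eq_abs, abs_pow]
    exact pow_le_pow_left₀ (abs_nonneg _) (abs_kernel_le hb ht x) 2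
  have hW : Integrable ((Icc (t - δ) (t + δ)).indicator fun _ : ℝ => c ^ 2)
      (volume.restrict (Icc 0 1)) := (integrable_const _).indicator measurableSet_Icc
  have hWi : ∫ x in Icc (0 : ℝ) 1, (Icc (t - δ) (t + δ)).indicator (fun _ : ℝ => c ^ 2) x ≤
      2 * δ * c ^ 2 := by
    have h3 : ∫ x in Icc (0 : ℝ) 1, (Icc (t - δ) (t + δ)).indicator (fun _ : ℝ => c ^ 2) x ≤
        ∫ x, (Icc (t - δ) (t + δ)).indicator (fun _ : ℝ => c ^ 2) x := by
      refine setIntegral_le_integral ?_ (Eventually.of_forall fun x => ?_)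
      · exact (integrable_indicator_iff measurableSet_Icc).mpr
          (continuousOn_const.integrableOn_Icc)
      · exact indicator_nonneg (fun _ _ => by positivity) x
    refine h3.trans_eq ?_
    rw [integral_indicator measurableSet_Icc, setIntegral_const, Real.volume_real_Icc_of_le
      (by linarith), smul_eq_mul]
    ring
  have hle : ∫ x in Icc (0 : ℝ) 1, (2 * c * kernel t b x -
      2 * c / δ ^ 2 * ((x - t) ^ 2 * kernel t b x) -
        (Icc (t - δ) (t + δ)).indicator (fun _ : ℝ => c ^ 2) x) ≤
      ∫ x in Icc (0 : ℝ) 1, kernel t b x ^ 2 := by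
    refine integral_mono (IntegrableOn.fun_sub (IntegrableOn.fun_sub (h0.const_mul _)
      (h2.const_mul _)) hW) hK2 fun x => ?_
    have hK := kernel_nonneg hb ht x
    by_cases hx : x ∈ Icc (t - δ) (t + δ)
    · simp only [indicator_of_mem hx]
      have h3 : 0 ≤ 2 * c / δ ^ 2 * ((x - t) ^ 2 * kernel t b x) := by positivity
      nlinarith [sq_nonneg (kernel t b x - c)]
    · simp only [indicator_of_notMem hx]
      have h3 : δ ^ 2 ≤ (x - t) ^ 2 := by
        rw [← sq_abs (x - t)]
        refine pow_le_pow_left₀ hδ0.le ?_ 2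
        by_contra hlt
        have := abs_lt.mp (not_le.mp hlt)
        exact hx ⟨by linarith, by linarith⟩
      have h4 : 2 * c * kernel t b x ≤ 2 * c / δ ^ 2 * ((x - t) ^ 2 * kernel t b x) := by
        calc 2 * c * kernel t b x = 2 * c / δ ^ 2 * (δ ^ 2 * kernel t b x) := by field_simp
          _ ≤ _ := by gcongr
      nlinarith [sq_nonneg (kernel t b x)]
  rw [integral_sub (IntegrableOn.fun_sub (h0.const_mul _) (h2.const_mul _)) hW,
    integral_sub (h0.const_mul _) (h2.const_mul _), integral_const_mul, integral_const_mul,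
    setIntegral_kernel hb ht] at hle
  have hm2 := setIntegral_sub_sq_mul_kernel_le hb hbt ht1
  have h5 : 2 * c / δ ^ 2 * ∫ x in Icc (0 : ℝ) 1, (x - t) ^ 2 * kernel t b x ≤ c / 2 := by
    calc _ ≤ 2 * c / δ ^ 2 * (3 * (b * t)) := by gcongr
      _ = 24 / 49 * c := by rw [← hs2, hδ]; field_simp; norm_num
      _ ≤ c / 2 := by linarith
  have h6 : 2 * δ * c ^ 2 = 3 / 4 * c := by rw [hc]; field_simp; norm_num
  have h7 : 3 / 4 * c ≤ ∫ x in Icc (0 : ℝ) 1, kernel t b x ^ 2 := by linarith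
  have h8 : 3 / 4 * c = 9 / 112 / s := by rw [hc, hδ]; field_simp; norm_num
  have h9 : 1 / (32 * s) + 1 ≤ 9 / 112 / s := by
    rw [div_add_one (by positivity), div_le_div_iff₀ (by positivity) hs0]
    nlinarith
  linarith

/-- Lower bound for the stochastic error of the beta kernel estimator. The variance
`n⁻¹ (b t) ^ (-1 / 2)` near the boundary has an integral of order `p / 2` that is at least
logarithmic as soon as `p ≥ 4`. -/
lemma ofReal_log_le_rpow_maxRisk {p β L b : ℝ} {n : ℕ} (hp : 4 ≤ p) (hβ : 0 < β) (hβ2 : β ≤ 2)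
    (hL : 0 < L) (hn : n ≠ 0) (hb : 0 < b) (hb1 : b ≤ 1 / 1000) :
    ENNReal.ofReal ((32 * n * Real.sqrt b) ^ (-(p / 2)) * Real.log (1 / b)) ≤
      maxRisk p n (estimator b n) β L ^ p := by
  have hn' : 0 < (n : ℝ) := by positivity
  have hf : IsHolderDensity β L fun _ => 1 := isHolderDensity_one hβ hβ2 hL.le
  have hprob := hf.isProbabilityMeasure_law hβ hβ2
  have hP : IsProbabilityMeasure (sampleLaw n fun _ => 1) := by unfold sampleLaw; infer_instance
  have h1 := lintegral_variance_le_rpow_risk (p := p) (β := β) (L := L) (n := n)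
    (G := fun t x => kernel t b x) (by linarith) hβ hβ2 hL.le hn
    (aemeasurable_estimator hb n _) (fun t _ => measurable_kernel t b)
    (fun t ht => ⟨_, abs_kernel_le hb ht⟩) (fun t ht => setIntegral_kernel hb ht)
  refine le_trans ?_ (h1.trans (ENNReal.rpow_le_rpow (risk_le_maxRisk hf) (by linarith)))
  set A : ℝ := (32 * n * Real.sqrt b) ^ (-(p / 2)) with hA
  have hsb : 0 < Real.sqrt b := Real.sqrt_pos.mpr hb
  have hA0 : 0 < A := by positivity
  have hcont : ContinuousOn (fun t : ℝ => A * t⁻¹) (Icc b 1) :=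
    continuousOn_const.mul (continuousOn_id.inv₀ fun t ht => (hb.trans_le ht.1).ne')
  have hlog : ∫ t in Icc b 1, A * t⁻¹ = A * Real.log (1 / b) := by
    rw [integral_Icc_eq_integral_Ioc, ← intervalIntegral.integral_of_le (by linarith),
      intervalIntegral.integral_const_mul, integral_inv_of_pos hb one_pos]
  rw [← hlog, ofReal_integral_eq_lintegral_ofReal hcont.integrableOn_Icc
    (ae_restrict_of_forall_mem measurableSet_Icc fun t ht => by
      have := hb.trans_le ht.1
      simp only [Pi.zero_apply]; positivity)]
  refine le_trans (setLIntegral_mono' measurableSet_Icc fun t ht => ?_)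
    (lintegral_mono_set (Icc_subset_Icc_left hb.le))
  have ht0 : 0 < t := hb.trans_le ht.1
  have hv := le_setIntegral_kernel_sq_sub_one hb hb1 ht.1 ht.2
  have hst : 0 < Real.sqrt t := Real.sqrt_pos.mpr ht0
  have h2 : (32 * n * Real.sqrt b * Real.sqrt t)⁻¹ ≤
      1 / n * ((∫ x in Icc (0 : ℝ) 1, kernel t b x ^ 2) - 1) := by
    calc _ = 1 / n * (1 / (32 * Real.sqrt (b * t))) := by
          rw [Real.sqrt_mul hb.le]; field_simp
      _ ≤ _ := by gcongr
  refine le_trans ?_ (ENNReal.rpow_le_rpow (ENNReal.ofReal_le_ofReal h2) (by linarith))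
  rw [ENNReal.ofReal_rpow_of_pos (by positivity)]
  refine ENNReal.ofReal_le_ofReal ?_
  rw [← Real.rpow_neg_eq_inv_rpow, Real.mul_rpow (by positivity) hst.le]
  refine mul_le_mul_of_nonneg_left ?_ hA0.le
  rw [Real.sqrt_eq_rpow, ← Real.rpow_mul ht0.le, ← Real.rpow_neg_one]
  exact Real.rpow_le_rpow_of_exponent_ge ht0 ht.2 (by linarith)

lemma lintegral_kernel_bias_le_rpow_maxRisk {p β L b : ℝ} {n : ℕ} {f : ℝ → ℝ} (hp : 1 ≤ p)
    (hβ : 0 < β) (hβ2 : β ≤ 2) (hf : IsHolderDensity β L f) (hn : n ≠ 0) (hb : 0 < b) :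
    ∫⁻ t in Icc (0 : ℝ) 1,
        ENNReal.ofReal |(∫ x in Icc (0 : ℝ) 1, f x * kernel t b x) - f t| ^ p ≤
      maxRisk p n (estimator b n) β L ^ p := by
  have hprob := hf.isProbabilityMeasure_law hβ hβ2
  have hP : IsProbabilityMeasure (sampleLaw n f) := by unfold sampleLaw; infer_instance
  exact (lintegral_bias_le_rpow_risk hp hβ hβ2 hf hn (aemeasurable_estimator hb n _)
    (fun t _ => measurable_kernel t b) (fun t ht => ⟨_, abs_kernel_le hb ht⟩)).trans
    (ENNReal.rpow_le_rpow (risk_le_maxRisk hf) (by linarith))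

/-- The bias at a density of slope `a`. -/
lemma setIntegral_affine_mul_kernel_sub {a b t : ℝ} (hb : 0 < b) (ht : t ∈ Icc (0 : ℝ) 1) :
    (∫ x in Icc (0 : ℝ) 1, (1 + a * (x - 1 / 2)) * kernel t b x) - (1 + a * (t - 1 / 2)) =
      a * (b * (1 - 2 * t) / (1 + 2 * b)) := by
  have h0 : IntegrableOn (fun x => kernel t b x) (Icc 0 1) := by
    simpa using integrableOn_mul_kernel hb ht (g := fun _ => 1) continuous_const
  have h1 := integrableOn_mul_kernel hb ht (g := fun x => x) (by fun_prop)
  have hx : ∀ x, (1 + a * (x - 1 / 2)) * kernel t b x =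
      (1 - a / 2) * kernel t b x + a * (x * kernel t b x) := fun x => by ring
  simp_rw [hx]
  rw [integral_add (h0.const_mul _) (h1.const_mul _), integral_const_mul, integral_const_mul,
    setIntegral_kernel hb ht, (kernel_moments hb ht).1]
  field_simp
  ring

lemma ofReal_le_of_rpow_le {p c : ℝ} {R : ENNReal} (hp : 0 < p)
    (h : ENNReal.ofReal c ^ p ≤ R ^ p) : ENNReal.ofReal c ≤ R :=
  (ENNReal.rpow_le_rpow_iff hp).mp h

/-- Restricting an integral over `[0, 1]` to an interval of length `ℓ` costs at most a factor `ℓ` in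
the `L^p` norm. -/
lemma ofReal_mul_rpow_le_lintegral {p c u v : ℝ} {F : ℝ → ENNReal} (hp : 1 ≤ p) (hc : 0 ≤ c)
    (hu : 0 ≤ u) (huv : u ≤ v) (hv : v ≤ 1) (hF : ∀ t ∈ Icc u v, ENNReal.ofReal c ^ p ≤ F t) :
    ENNReal.ofReal ((v - u) * c) ^ p ≤ ∫⁻ t in Icc (0 : ℝ) 1, F t := by
  have h1 : ∫⁻ t in Icc u v, ENNReal.ofReal c ^ p ≤ ∫⁻ t in Icc (0 : ℝ) 1, F t :=
    (setLIntegral_mono' measurableSet_Icc hF).trans (lintegral_mono_set (Icc_subset_Icc hu hv))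
  rw [lintegral_const, Measure.restrict_apply_univ, Real.volume_Icc] at h1
  refine le_trans ?_ h1
  rw [mul_comm (v - u), ENNReal.ofReal_mul hc, ENNReal.mul_rpow_of_nonneg _ _ (by linarith)]
  gcongr
  rw [ENNReal.ofReal_rpow_of_nonneg (by linarith) (by linarith)]
  refine ENNReal.ofReal_le_ofReal ?_
  simpa using Real.rpow_le_rpow_of_exponent_ge' (by linarith : 0 ≤ v - u) (by linarith)
    zero_le_one hp

lemma ofReal_affine_bias_le_maxRisk {p β L a b : ℝ} {n : ℕ} (hp : 1 ≤ p)
    (hβ : 0 < β) (hβ2 : β ≤ 2) (ha : 0 ≤ a) (ha1 : a ≤ 1) (haL : a ≤ L) (hn : n ≠ 0) (hb : 0 < b)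
    (hb1 : b ≤ 1) :
    ENNReal.ofReal (a * b / 24) ≤ maxRisk p n (estimator b n) β L := by
  refine ofReal_le_of_rpow_le (p := p) (by linarith) (le_trans ?_
    (lintegral_kernel_bias_le_rpow_maxRisk hp hβ hβ2 (isHolderDensity_affine hβ hβ2 ha ha1 haL)
      hn hb))
  have h1 : a * b / 24 = (1 / 4 - 0) * (a * b / 6) := by ring
  rw [h1]
  refine ofReal_mul_rpow_le_lintegral hp (by positivity) le_rfl (by norm_num) (by norm_num)
    fun t ht => ?_
  refine ENNReal.rpow_le_rpow (ENNReal.ofReal_le_ofReal ?_) (by linarith)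
  obtain ⟨ht0, ht1⟩ := ht
  rw [setIntegral_affine_mul_kernel_sub hb ⟨ht0, by linarith⟩]
  refine le_trans ?_ (le_abs_self _)
  rw [mul_div_assoc]
  refine mul_le_mul_of_nonneg_left ?_ ha
  rw [div_le_div_iff₀ (by norm_num) (by positivity)]
  nlinarith

/-- `1 - cos y ≥ (2 / π ^ 2) y ^ 2 (1 - y ^ 2 / π ^ 2)`, at `y = 2 π k d`. -/
lemma le_one_sub_cos (k d : ℝ) :
    8 * k ^ 2 * d ^ 2 - 32 * k ^ 4 * d ^ 4 ≤ 1 - Real.cos (2 * Real.pi * k * d) := by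
  have hpi := Real.pi_pos
  rcases le_or_gt (|2 * Real.pi * k * d|) Real.pi with h | h
  · have h1 := Real.cos_le_one_sub_mul_cos_sq h
    have h2 : 2 / Real.pi ^ 2 * (2 * Real.pi * k * d) ^ 2 = 8 * k ^ 2 * d ^ 2 := by
      field_simp; ring
    have h3 : 0 ≤ 32 * k ^ 4 * d ^ 4 := by positivity
    linarith
  · have h1 : 1 ≤ (2 * k * d) ^ 2 := by
      have h2 : |2 * Real.pi * k * d| = Real.pi * |2 * k * d| := by
        rw [← abs_of_pos hpi, ← abs_mul, abs_of_pos hpi]; ring_nf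
      rw [h2] at h
      have h3 : 1 < |2 * k * d| := by
        by_contra hc
        nlinarith [not_lt.mp hc]
      rw [← sq_abs]
      nlinarith
    have h4 := Real.cos_le_one (2 * Real.pi * k * d)
    nlinarith [sq_nonneg (2 * k * d)]

/-- The biases at the cosine and at the sine of one frequency cannot both be small: a combination
of them is the mean of `1 - cos (2 π k (X - t))`, in which the bias of first order of the kernel
cancels. -/
lemma le_abs_bias_cos_add_abs_bias_sin {a b t k : ℝ} (ha : 0 ≤ a) (hb : 0 < b) (hb1 : b ≤ 1)
    (ht : t ∈ Icc (1 / 4 : ℝ) (3 / 4)) :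
    a * (8 * k ^ 2 * (b / 64) - 32 * k ^ 4 * (32 * b ^ 2)) ≤
      |(∫ x in Icc (0 : ℝ) 1, (1 + a * Real.cos (2 * Real.pi * k * x)) * kernel t b x) -
        (1 + a * Real.cos (2 * Real.pi * k * t))| +
      |(∫ x in Icc (0 : ℝ) 1, (1 + a * Real.sin (2 * Real.pi * k * x)) * kernel t b x) -
        (1 + a * Real.sin (2 * Real.pi * k * t))| := by
  have ht' : t ∈ Icc (0 : ℝ) 1 := ⟨by linarith [ht.1], by linarith [ht.2]⟩
  set w := 2 * Real.pi * k with hw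
  have h0 : IntegrableOn (fun x => kernel t b x) (Icc 0 1) := by
    simpa using integrableOn_mul_kernel hb ht' (g := fun _ => 1) continuous_const
  have hic := integrableOn_mul_kernel hb ht' (g := fun x => Real.cos (w * x)) (by fun_prop)
  have his := integrableOn_mul_kernel hb ht' (g := fun x => Real.sin (w * x)) (by fun_prop)
  have hi2 := integrableOn_mul_kernel hb ht' (g := fun x => (x - t) ^ 2) (by fun_prop)
  have hi4 := integrableOn_mul_kernel hb ht' (g := fun x => (x - t) ^ 4) (by fun_prop)
  have hid := integrableOn_mul_kernel hb ht' (g := fun x => 1 - Real.cos (w * (x - t)))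
    (by fun_prop)
  set C := ∫ x in Icc (0 : ℝ) 1, Real.cos (w * x) * kernel t b x with hC
  set S := ∫ x in Icc (0 : ℝ) 1, Real.sin (w * x) * kernel t b x with hS
  have hone : ∀ g : ℝ → ℝ, IntegrableOn (fun x => g x * kernel t b x) (Icc 0 1) →
      (∫ x in Icc (0 : ℝ) 1, (1 + a * g x) * kernel t b x) - (1 + a * g t) =
        a * ((∫ x in Icc (0 : ℝ) 1, g x * kernel t b x) - g t) := fun g hg => by
    have hx : ∀ x, (1 + a * g x) * kernel t b x = kernel t b x + a * (g x * kernel t b x) :=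
      fun x => by ring
    simp_rw [hx]
    rw [integral_add h0 (hg.const_mul _), integral_const_mul, setIntegral_kernel hb ht']
    ring
  rw [hone _ hic, hone _ his, abs_mul, abs_mul, abs_of_nonneg ha, ← mul_add]
  refine mul_le_mul_of_nonneg_left ?_ ha
  have hcomb : ∫ x in Icc (0 : ℝ) 1, (1 - Real.cos (w * (x - t))) * kernel t b x =
      1 - (Real.cos (w * t) * C + Real.sin (w * t) * S) := by
    have hx : ∀ x, (1 - Real.cos (w * (x - t))) * kernel t b x =
        kernel t b x - (Real.cos (w * t) * (Real.cos (w * x) * kernel t b x) +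
          Real.sin (w * t) * (Real.sin (w * x) * kernel t b x)) := fun x => by
      rw [mul_sub, Real.cos_sub]; ring
    simp_rw [hx]
    rw [integral_sub h0 (Integrable.fun_add (hic.const_mul _) (his.const_mul _)),
      integral_add (hic.const_mul _) (his.const_mul _), integral_const_mul, integral_const_mul,
      setIntegral_kernel hb ht']
  have hlow : 8 * k ^ 2 * (b / 64) - 32 * k ^ 4 * (32 * b ^ 2) ≤
      ∫ x in Icc (0 : ℝ) 1, (1 - Real.cos (w * (x - t))) * kernel t b x := by
    have h2 := le_setIntegral_sub_sq_mul_kernel hb hb1 ht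
    have h4 := setIntegral_sub_pow_four_mul_kernel_le hb hb1 ht'
    calc 8 * k ^ 2 * (b / 64) - 32 * k ^ 4 * (32 * b ^ 2) ≤
        8 * k ^ 2 * (∫ x in Icc (0 : ℝ) 1, (x - t) ^ 2 * kernel t b x) -
          32 * k ^ 4 * ∫ x in Icc (0 : ℝ) 1, (x - t) ^ 4 * kernel t b x := by gcongr
      _ = ∫ x in Icc (0 : ℝ) 1, (8 * k ^ 2 * ((x - t) ^ 2 * kernel t b x) -
          32 * k ^ 4 * ((x - t) ^ 4 * kernel t b x)) := by
          rw [integral_sub (hi2.const_mul _) (hi4.const_mul _), integral_const_mul,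
            integral_const_mul]
      _ ≤ _ := by
          refine integral_mono (IntegrableOn.fun_sub (hi2.const_mul _) (hi4.const_mul _)) hid
            fun x => ?_
          have h5 := mul_le_mul_of_nonneg_right (le_one_sub_cos k (x - t))
            (kernel_nonneg hb ht' x)
          simp only
          linarith
  have hid2 : 1 - (Real.cos (w * t) * C + Real.sin (w * t) * S) =
      Real.cos (w * t) * (Real.cos (w * t) - C) + Real.sin (w * t) * (Real.sin (w * t) - S) := by
    linear_combination -(Real.sin_sq_add_cos_sq (w * t))
  rw [hcomb, hid2] at hlow
  refine hlow.trans (add_le_add ?_ ?_)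
  · refine (le_abs_self _).trans ?_
    rw [abs_mul, abs_sub_comm]
    exact mul_le_of_le_one_left (abs_nonneg _) (Real.abs_cos_le_one _)
  · refine (le_abs_self _).trans ?_
    rw [abs_mul, abs_sub_comm]
    exact mul_le_of_le_one_left (abs_nonneg _) (Real.abs_sin_le_one _)

/-- The numerical bounds on `k ^ 2 * b` make the second moment term of `le_one_sub_cos` dominate the
fourth moment term, and keep it bounded below. -/
lemma ofReal_oscillation_bias_le_maxRisk {p β L a b : ℝ} {n k : ℕ} (hp : 1 ≤ p)
    (hβ : 0 < β) (hβ2 : β ≤ 2) (ha : 0 ≤ a) (ha1 : a ≤ 1) (hk : k ≠ 0)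
    (haL : 2 * a * (2 * Real.pi * k) ^ β ≤ L) (hn : n ≠ 0) (hb : 0 < b) (hb1 : b ≤ 1)
    (hkb : k ^ 2 * b ≤ 1 / 2 ^ 14) (hkb' : 1 / 2 ^ 16 ≤ k ^ 2 * b) :
    ENNReal.ofReal (a / 2 ^ 23) ≤ maxRisk p n (estimator b n) β L := by
  have hp0 : 0 < p := by linarith
  set R := maxRisk p n (estimator b n) β L with hR
  have hc := lintegral_kernel_bias_le_rpow_maxRisk (n := n) (b := b) hp hβ hβ2
    (isHolderDensity_cos hk hβ hβ2 ha ha1 haL) hn hb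
  have hs := lintegral_kernel_bias_le_rpow_maxRisk (n := n) (b := b) hp hβ hβ2
    (isHolderDensity_sin hk hβ hβ2 ha ha1 haL) hn hb
  have hsum := add_le_add hc hs
  have hmeas : AEMeasurable (fun t => ENNReal.ofReal |(∫ x in Icc (0 : ℝ) 1,
      (1 + a * Real.cos (2 * Real.pi * k * x)) * kernel t b x) -
        (1 + a * Real.cos (2 * Real.pi * k * t))| ^ p) (volume.restrict (Icc 0 1)) := by
    have h1 := (aemeasurable_setIntegral_mul_kernel hb
      (f := fun x => 1 + a * Real.cos (2 * Real.pi * k * x)) (by fun_prop)).sub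
      (Measurable.aemeasurable (f := fun t => 1 + a * Real.cos (2 * Real.pi * k * t))
        (by fun_prop))
    exact ((measurable_norm.comp_aemeasurable h1).ennreal_ofReal).pow_const p
  rw [← lintegral_add_left' hmeas] at hsum
  have hlow : ENNReal.ofReal ((3 / 4 - 1 / 4) * (a / 2 ^ 21)) ^ p ≤ R ^ p + R ^ p := by
    refine (ofReal_mul_rpow_le_lintegral hp (by positivity) (by norm_num) (by norm_num)
      (by norm_num) fun t ht => ?_).trans hsum
    have h1 := le_abs_bias_cos_add_abs_bias_sin (k := k) ha hb hb1 ht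
    have h2 : 1 / 2 ^ 20 ≤ 8 * (k : ℝ) ^ 2 * (b / 64) - 32 * (k : ℝ) ^ 4 * (32 * b ^ 2) := by
      have : 8 * (k : ℝ) ^ 2 * (b / 64) - 32 * (k : ℝ) ^ 4 * (32 * b ^ 2) =
          (k ^ 2 * b) * (1 / 8 - 1024 * (k ^ 2 * b)) := by ring
      rw [this]
      nlinarith
    have h3 : a * (1 / 2 ^ 20) ≤ _ := (mul_le_mul_of_nonneg_left h2 ha).trans h1
    -- One of the two biases is at least half the lower bound for their sum.
    rcases le_or_gt (a / 2 ^ 21) |(∫ x in Icc (0 : ℝ) 1,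
      (1 + a * Real.cos (2 * Real.pi * k * x)) * kernel t b x) -
        (1 + a * Real.cos (2 * Real.pi * k * t))| with h | h
    · exact (ENNReal.rpow_le_rpow (ENNReal.ofReal_le_ofReal h) hp0.le).trans le_self_add
    · refine (ENNReal.rpow_le_rpow (ENNReal.ofReal_le_ofReal ?_) hp0.le).trans le_add_self
      linarith
  refine ofReal_le_of_rpow_le hp0 ?_
  have h5 : ENNReal.ofReal ((3 / 4 - 1 / 4) * (a / 2 ^ 21)) = 2 * ENNReal.ofReal (a / 2 ^ 23) := by
    rw [← ENNReal.ofReal_ofNat 2, ← ENNReal.ofReal_mul (by norm_num)]; congr 1; ring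
  rw [h5, ENNReal.mul_rpow_of_nonneg _ _ hp0.le, ← two_mul] at hlow
  have h6 : (2 : ENNReal) ≤ 2 ^ p := by
    simpa using ENNReal.rpow_le_rpow_of_exponent_le (x := 2) (by norm_num) hp
  exact (ENNReal.mul_le_mul_iff_right two_ne_zero (by norm_num)).mp
    ((mul_le_mul_left h6 _).trans hlow)

/-- Lower bound for the bias of the beta kernel estimator over the Hölder class. -/
lemma exists_rpow_le_maxRisk {p β L : ℝ} (hp : 1 ≤ p) (hβ : 0 < β) (hβ2 : β ≤ 2) (hL : 0 < L) :
    ∃ c : ℝ, 0 < c ∧ ∀ n : ℕ, n ≠ 0 → ∀ b ∈ Ioo (0 : ℝ) 1,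
      ENNReal.ofReal (c * Real.sqrt b ^ β) ≤ maxRisk p n (estimator b n) β L := by
  set ε : ℝ := min 1 (L / (2 * (2 * Real.pi) ^ β)) with hε
  have hε0 : 0 < ε := by positivity
  have hε1 : ε ≤ 1 := min_le_left _ _
  have hεL : 2 * ε * (2 * Real.pi) ^ β ≤ L := by
    have : ε ≤ L / (2 * (2 * Real.pi) ^ β) := min_le_right _ _
    rw [le_div_iff₀ (by positivity)] at this
    linarith
  set e : ℝ := min 1 L with he
  have he0 : 0 < e := by positivity
  refine ⟨min (ε / 2 ^ 23) (e / 24 / 2 ^ 14), by positivity, fun n hn b hb => ?_⟩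
  obtain ⟨hb0, hb1⟩ := hb
  have hs0 : 0 < Real.sqrt b := Real.sqrt_pos.mpr hb0
  have hs2 : Real.sqrt b ^ 2 = b := Real.sq_sqrt hb0.le
  have hs1 : Real.sqrt b ≤ 1 := by
    rw [Real.sqrt_le_one]; exact hb1.le
  have hsβ : Real.sqrt b ^ β ≤ 1 := Real.rpow_le_one hs0.le hs1 hβ.le
  rcases le_or_gt b (1 / 2 ^ 14) with h | h
  · -- The frequency is chosen such that `k ^ 2 * b` is of order one.
    set y : ℝ := 1 / (2 ^ 7 * Real.sqrt b) with hy
    have hy1 : 1 ≤ y := by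
      rw [hy, le_div_iff₀ (by positivity), one_mul]
      refine abs_le_of_sq_le_sq' ?_ (by norm_num) |>.2
      rw [mul_pow, hs2]; linarith
    have hyb : y ^ 2 * b = 1 / 2 ^ 14 := by
      rw [hy, div_pow, mul_pow, hs2]; field_simp
    set k := ⌊y⌋₊ with hk
    have hk1 : 1 ≤ k := Nat.one_le_floor_iff _ |>.mpr hy1
    have hk1' : (1 : ℝ) ≤ k := by exact_mod_cast hk1
    have hky : (k : ℝ) ≤ y := Nat.floor_le (by linarith)
    have hyk : y ≤ 2 * k := by linarith [Nat.lt_floor_add_one y]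
    have hkpos : 0 < (k : ℝ) := by linarith
    have h1 := ofReal_oscillation_bias_le_maxRisk (p := p) (β := β) (L := L) (n := n) (b := b)
      (k := k) (a := ε * (k : ℝ) ^ (-β)) hp hβ hβ2 (by positivity) ?_ (by omega) ?_ hn hb0 hb1.le
      ?_ ?_
    · refine le_trans (ENNReal.ofReal_le_ofReal ?_) h1
      have h2 : Real.sqrt b ^ β ≤ (k : ℝ) ^ (-β) := by
        rw [Real.rpow_neg hkpos.le, ← Real.inv_rpow hkpos.le]
        refine Real.rpow_le_rpow hs0.le ?_ hβ.le
        rw [le_inv_comm₀ hs0 hkpos]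
        refine hky.trans ?_
        rw [hy, ← one_div]
        gcongr
        linarith
      calc _ ≤ ε / 2 ^ 23 * (k : ℝ) ^ (-β) := by
            gcongr; exact min_le_left _ _
        _ = _ := by ring
    · exact mul_le_one₀ hε1 (by positivity) (Real.rpow_le_one_of_one_le_of_nonpos hk1' (by linarith))
    · rw [Real.mul_rpow (by positivity) hkpos.le, Real.rpow_neg hkpos.le]
      have : (k : ℝ) ^ β ≠ 0 := by positivity
      calc _ = 2 * ε * (2 * Real.pi) ^ β := by field_simp
        _ ≤ L := hεL
    · rw [← hyb]; gcongr
    · have : y ^ 2 * b ≤ (2 * k) ^ 2 * b := by gcongr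
      rw [hyb] at this
      linarith
  · refine le_trans (ENNReal.ofReal_le_ofReal ?_) (ofReal_affine_bias_le_maxRisk (p := p) (n := n)
      hp hβ hβ2 he0.le (min_le_left _ _) (min_le_right _ _) hn hb0 hb1.le)
    calc _ ≤ e / 24 / 2 ^ 14 * 1 := by
          gcongr; exact min_le_right _ _
      _ = e * (1 / 2 ^ 14) / 24 := by ring
      _ ≤ _ := by gcongr

/-- For every choice of bandwidths, the maximal risk of the beta kernel estimator is of larger order
than `n ^ (-β / (2 β + 1))`: a bandwidth of order more than `n ^ (-2 / (2 β + 1))` makes the bias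
too large, and for any other one the logarithm in the stochastic error diverges. -/
theorem eventually_le_maxRisk {p β L : ℝ} (hp : 4 ≤ p) (hβ : 0 < β) (hβ2 : β ≤ 2) (hL : 0 < L)
    {b : ℕ → ℝ} (hb : ∀ n, b n ∈ Ioo (0 : ℝ) 1) {K : ℝ} (hK : 0 < K) :
    ∀ᶠ n : ℕ in atTop, ENNReal.ofReal (K * (n : ℝ) ^ (-(β / (2 * β + 1)))) ≤
      maxRisk p n (estimator (b n) n) β L := by
  have hp0 : 0 < p := by linarith
  obtain ⟨c, hc0, hc⟩ := exists_rpow_le_maxRisk (p := p) (by linarith) hβ hβ2 hL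
  -- Bound for `√(b n)` where the bias is below the target.
  set A : ℝ := (K / c) ^ (1 / β) with hA
  have hA0 : 0 < A := by positivity
  set B : ℝ := (32 * A) ^ (-(p / 2)) with hB
  have hB0 : 0 < B := by positivity
  have hlim : Tendsto (fun n : ℕ => A * (n : ℝ) ^ (-(1 / (2 * β + 1)))) atTop (nhds 0) := by
    have : Tendsto (fun n : ℕ => (n : ℝ) ^ (-(1 / (2 * β + 1)))) atTop (nhds 0) :=
      (tendsto_rpow_neg_atTop (by positivity)).comp tendsto_natCast_atTop_atTop
    simpa using this.const_mul A
  have hexp : 0 < Real.exp (-(K ^ p / B)) := Real.exp_pos _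
  filter_upwards [hlim.eventually (ge_mem_nhds (by norm_num : (0 : ℝ) < 1 / 1000)),
    hlim.eventually (ge_mem_nhds hexp), eventually_ge_atTop 1] with n hn1 hn2 hn3
  have hn : 1 ≤ (n : ℝ) := by exact_mod_cast hn3
  have hn0 : 0 < (n : ℝ) := by linarith
  set h : ℝ := (n : ℝ) ^ (-(1 / (2 * β + 1))) with hh
  set r : ℝ := (n : ℝ) ^ (-(β / (2 * β + 1))) with hr
  have hh0 : 0 < h := by positivity
  have hr0 : 0 < r := by positivity
  have hrh : h ^ β = r := by
    rw [hh, hr, ← Real.rpow_mul hn0.le]; congr 1; field_simp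
  have hrn : n * h = r ^ (-2 : ℝ) := by
    rw [hh, hr, ← Real.rpow_mul hn0.le]
    nth_rewrite 1 [← Real.rpow_one (n : ℝ)]
    rw [← Real.rpow_add hn0]
    congr 1
    field_simp
    ring
  obtain ⟨hb0, hb1⟩ := hb n
  have hs0 : 0 < Real.sqrt (b n) := Real.sqrt_pos.mpr hb0
  rcases le_or_gt (A * h) (Real.sqrt (b n)) with hcase | hcase
  · refine le_trans (ENNReal.ofReal_le_ofReal ?_) (hc n (by omega) _ (hb n))
    have h1 : (A * h) ^ β ≤ Real.sqrt (b n) ^ β := Real.rpow_le_rpow (by positivity) hcase hβ.le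
    rw [Real.mul_rpow hA0.le hh0.le, hrh, hA, ← Real.rpow_mul (by positivity),
      one_div_mul_cancel hβ.ne', Real.rpow_one] at h1
    calc K * r = c * (K / c * r) := by field_simp
      _ ≤ _ := by gcongr
  · have hbs : b n ≤ Real.sqrt (b n) := by
      rw [Real.le_sqrt hb0.le hb0.le]; nlinarith
    have hbsmall : b n ≤ 1 / 1000 := by linarith
    refine ofReal_le_of_rpow_le hp0 (le_trans ?_ (ofReal_log_le_rpow_maxRisk hp hβ hβ2 hL
      (by omega) hb0 hbsmall))
    rw [ENNReal.ofReal_rpow_of_nonneg (by positivity) hp0.le]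
    refine ENNReal.ofReal_le_ofReal ?_
    have hlog : K ^ p / B ≤ Real.log (1 / b n) := by
      rw [one_div, Real.log_inv, le_neg, ← Real.log_exp (-(K ^ p / B))]
      exact Real.log_le_log hb0 (by linarith)
    have hpow : B * r ^ p ≤ (32 * n * Real.sqrt (b n)) ^ (-(p / 2)) := by
      have e1 : B * r ^ p = (32 * n * (A * h)) ^ (-(p / 2)) := by
        rw [show 32 * (n : ℝ) * (A * h) = (32 * A) * (n * h) by ring, hrn,
          Real.mul_rpow (by positivity) (by positivity), ← Real.rpow_mul hr0.le]
        congr 2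
        ring
      rw [e1]
      refine Real.rpow_le_rpow_of_nonpos (by positivity) ?_ (by linarith)
      gcongr
    calc (K * r) ^ p = (B * r ^ p) * (K ^ p / B) := by
          rw [Real.mul_rpow hK.le hr0.le]; field_simp
      _ ≤ _ := by gcongr

end BetaKernel

end

theorem theorem3 (p β L : ℝ) (hp : 4 ≤ p) (hβ : 0 < β) (hβ2 : β ≤ 2) (hL : 0 < L)
    (b : ℕ → ℝ) (hb : ∀ n, b n ∈ Set.Ioo (0 : ℝ) 1) :
    Filter.liminf
      (fun n : ℕ => BetaKernel.maxRisk p n (BetaKernel.estimator (b n) n) β L /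
        BetaKernel.minimaxRisk p n β L) Filter.atTop = ⊤ := by
  obtain ⟨C, hC0, hC⟩ := BetaKernel.exists_minimaxRisk_le (p := p) (by linarith) hβ hβ2 hL
  refine ENNReal.eq_top_of_forall_nnreal_le fun M => Filter.le_liminf_of_le (by isBoundedDefault) ?_
  have hK : 0 < C * (M + 1) := by positivity
  filter_upwards [hC, BetaKernel.eventually_le_maxRisk hp hβ hβ2 hL hb hK,
    Filter.eventually_ge_atTop 1] with n h1 h2 h3
  have hn0 : 0 < (n : ℝ) := by exact_mod_cast h3
  set r : ℝ := (n : ℝ) ^ (-(β / (2 * β + 1))) with hr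
  have hr0 : 0 < r := by positivity
  -- Where the minimax risk vanishes, `x / 0 = ⊤` for the positive maximal risk `x`.
  refine le_trans ?_ (ENNReal.div_le_div h2 h1)
  rw [← ENNReal.ofReal_div_of_pos (by positivity)]
  have h4 : C * (M + 1) * r / (C * r) = M + 1 := by field_simp
  rw [h4, ← ENNReal.ofReal_coe_nnreal]
  exact ENNReal.ofReal_le_ofReal (by linarith)
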